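/- Let $I=[0,1]$, let $0<\alpha\le 1$, let $\mathcal C\subset I$ be a finite set and let $f:I\setminus\mathcal C\to I$ be a piecewise $C^{1+\alpha}$ map: on each connected component of $I\setminus\mathcal C$ the map $f$ is monotone and differentiable with locally $\alpha$-Hölder derivative, and the one-sided limits $f(c^\pm)=\lim_{t\to c^\pm}f(t)$ exist for $c\in\mathcal C$. Let $\mathcal D$ be the set of one-sided points $c^+$ ($c\in\mathcal C$, $c<1$) and $c^-$ ($c\in\mathcal C$, $c>0$), with one-sided neighbourhoods $\Delta(c^+,\delta)=(c,c+\delta)$ and $\Delta(c^-,\delta)=(c-\delta,c)$; for $c\in\mathcal D$ write $f^j(c)$ for the one-sided limit of $f^j$ at $c$. (Distances to points of $\mathcal D$ are distances to the underlying points of $\mathcal C$.) Assume: 1. every $c\in\mathcal D$ has a critical order $0<\alpha(c)\le1$, that is, there are $\delta>0$ and $K\ge1$ such that for all $t\in\Delta(c,\delta)$ $$K^{-1}\le\frac{|f(t)-f(c)|}{|t-c|^{\alpha(c)}}\le K,\qquad K^{-1}\le\frac{|f'(t)|}{|t-c|^{\alpha(c)-1}}\le K;$$ put $\mathcal S=\{c\in\mathcal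 D:\alpha(c)<1\}$; 2. there is a constant $H$ such that for each $c\in\mathcal D\setminus\mathcal S$ there is $\delta>0$ with $|f'(t)-f'(s)|\le H|t-s|^\alpha$ for all $s,t\in\Delta(c,\delta)$; 3. $\inf\{|f'(x)|:x\in I\setminus\mathcal C\}>1$; 4. $\mathcal S\ne\emptyset$; 5. there is $T_0\in\mathbb Z^+$ such that for every $c\in\mathcal D\setminus\mathcal S$ there is $1\le T\le T_0$ with $f^T(c)\in\mathcal S$, such that for every $0<j<T$ there is $c_j\in\mathcal D\setminus\mathcal S$ with $d(f^j(c),\mathcal D)=d(f^j(c),c_j)$, and such that for some $\epsilon,\delta>0$ the iterate $f^T$ is defined on $\Delta(c,\delta)$ and maps it diffeomorphically onto its image, which is contained in the one-sided neighbourhood $\Delta(f^T(c),\epsilon)$ of the point $f^T(c)$ of $\mathcal S$. For $\delta>0$ let $\Delta_\delta(x)=|\log d_\delta(x,\mathcal D)|$, where $d_\delta(x,\mathcal D)$ equals $d(x,\mathcal D)$ if $0<d(x,\mathcal D)\le\delta$, equals $\frac{1-\delta}{\delta}d(x,\mathcal D)+2\delta-1$ if $\delta<d(x,\mathcal D)<2\delta$,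 and equals $1$ if $d(x,\mathcal D)\ge2\delta$. Then $f$ has exponentially slow recurrence to $\mathcal D$: for every $\epsilon>0$ there are $\delta>0$ and $\xi>0$ such that $$\limsup_{n\to\infty}\frac1n\log\lambda\Big\{t\in I:\frac1n\sum_{j=0}^{n-1}\Delta_\delta(f^j(t))>\epsilon\Big\}<-\xi,$$ where $\lambda$ is Lebesgue measure on $I$ and $\log 0=-\infty$. -/

import Mathlib

open Set Filter Topology MeasureTheory

namespace SlowRecurrence

noncomputable section

/-- The unit interval `I = [0,1]` as a set of reals. -/
abbrev I : Set ℝ := Icc (0 : ℝ) 1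

/-- The two sides from which a point of the line can be approached. -/
inductive Side
  | left
  | right

/-- A one-sided point `c⁻` (side `left`) or `c⁺` (side `right`). -/
structure OneSidedPoint where
  /-- the underlying point `c` of the line -/
  pos : ℝ
  /-- the side from which `c` is approached -/
  side : Side

/-- The one-sided neighbourhood `Δ(c⁺,δ) = (c, c+δ)`, resp. `Δ(c⁻,δ) = (c-δ, c)`. -/
def OneSidedPoint.nbhd (c : OneSidedPoint) (δ : ℝ) : Set ℝ :=
  match c.side with
  | Side.left => Ioo (c.pos - δ) c.pos
  | Side.right => Ioo c.pos (c.pos + δ)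

/-- The filter `t → c⁺`, resp. `t → c⁻`, of one-sided limits. -/
def OneSidedPoint.approach (c : OneSidedPoint) : Filter ℝ :=
  match c.side with
  | Side.left => 𝓝[<] c.pos
  | Side.right => 𝓝[>] c.pos

/-- `c` is a one-sided point of `I`: small one-sided neighbourhoods of `c` lie in `I`
(so `0⁻` and `1⁺` are excluded). -/
def OneSidedPoint.InInterval (c : OneSidedPoint) : Prop :=
  match c.side with
  | Side.left => 0 < c.pos ∧ c.pos ≤ 1
  | Side.right => 0 ≤ c.pos ∧ c.pos < 1

/-- The set `𝒟` of the one-sided points `c⁺`, `c⁻` of `I` with `c` in the finite set `C`. -/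
def oneSidedPoints (C : Finset ℝ) : Set OneSidedPoint :=
  {c | c.pos ∈ C ∧ c.InInterval}

/-- The derivative of `f` on `I` (one-sided at the end points of `I`). -/
def der (f : ℝ → ℝ) (t : ℝ) : ℝ := derivWithin f I t

/-- `f : I \ C → I` is a piecewise `C^{1+α}` interval map: it is monotone on each connected
component of `I \ C`, differentiable on `I \ C` with locally `α`-Hölder derivative, and has
one-sided limits at the points of `C`. The values of `f` outside `I \ C` play no role. -/
structure IsPiecewiseC1Alpha (f : ℝ → ℝ) (C : Finset ℝ) (α : ℝ) : Prop where
  subset : (C : Set ℝ) ⊆ I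
  mapsTo : MapsTo f (I \ C) I
  monotone : ∀ x ∈ I \ (C : Set ℝ),
    MonotoneOn f (connectedComponentIn (I \ C) x) ∨
      AntitoneOn f (connectedComponentIn (I \ C) x)
  differentiable : ∀ x ∈ I \ (C : Set ℝ), DifferentiableWithinAt ℝ f I x
  locallyHolder : ∀ x ∈ I \ (C : Set ℝ), ∃ r > 0, ∃ H : ℝ,
    ∀ s ∈ I ∩ Ioo (x - r) (x + r), ∀ t ∈ I ∩ Ioo (x - r) (x + r),
      |der f s - der f t| ≤ H * |s - t| ^ α
  lateralLimit : ∀ c ∈ oneSidedPoints C, ∃ L : ℝ, Tendsto f c.approach (𝓝 L)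

/-- The one-sided point `c` has critical order `β`: on some one-sided neighbourhood,
`|f(t) - f(c)| ≈ |t - c| ^ β` and `|f'(t)| ≈ |t - c| ^ (β - 1)`, where `f(c)` is the one-sided
limit of `f` at `c`, and `≈` means that the ratio is bounded above and below. -/
def HasCriticalOrder (f : ℝ → ℝ) (c : OneSidedPoint) (β : ℝ) : Prop :=
  ∃ L : ℝ, Tendsto f c.approach (𝓝 L) ∧
    ∃ δ > 0, ∃ K ≥ 1, ∀ t ∈ c.nbhd δ,
      (K⁻¹ * |t - c.pos| ^ β ≤ |f t - L| ∧ |f t - L| ≤ K * |t - c.pos| ^ β) ∧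
      (K⁻¹ * |t - c.pos| ^ (β - 1) ≤ |der f t| ∧ |der f t| ≤ K * |t - c.pos| ^ (β - 1))

/-- The singular set `𝒮`: the points of `𝒟` whose critical order lies in `(0,1)`. -/
def singularPoints (f : ℝ → ℝ) (C : Finset ℝ) : Set OneSidedPoint :=
  {c ∈ oneSidedPoints C | ∃ β : ℝ, 0 < β ∧ β < 1 ∧ HasCriticalOrder f c β}

/-- The set `𝒟 \ 𝒮` of nonsingular discontinuity points. -/
def regularPoints (f : ℝ → ℝ) (C : Finset ℝ) : Set OneSidedPoint :=
  oneSidedPoints C \ singularPoints f C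

/-- Every one-sided point of `𝒟` has a critical order in `(0,1]`. -/
def HasCriticalOrders (f : ℝ → ℝ) (C : Finset ℝ) : Prop :=
  ∀ c ∈ oneSidedPoints C, ∃ β : ℝ, 0 < β ∧ β ≤ 1 ∧ HasCriticalOrder f c β

/-- Near each point of `𝒟 \ 𝒮` the derivative of `f` is `α`-Hölder up to that point, with
a constant `H` common to all of them. -/
def IsHolderNearRegularPoints (f : ℝ → ℝ) (C : Finset ℝ) (α : ℝ) : Prop :=
  ∃ H : ℝ, ∀ c ∈ regularPoints f C, ∃ δ > 0, ∀ s ∈ c.nbhd δ, ∀ t ∈ c.nbhd δ,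
    |der f t - der f s| ≤ H * |t - s| ^ α

/-- `f` is uniformly expanding: `inf {|f'(x)| : x ∈ I \ C} > 1`. -/
def IsUniformlyExpanding (f : ℝ → ℝ) (C : Finset ℝ) : Prop :=
  ∃ σ > 1, ∀ x ∈ I \ (C : Set ℝ), σ ≤ |der f x|

/-- `g` restricted to the open set `U` is a `C¹` diffeomorphism onto its image, and the image
lies in `V`. -/
def IsDiffeoInto (g : ℝ → ℝ) (U V : Set ℝ) : Prop :=
  ContDiffOn ℝ 1 g U ∧ InjOn g U ∧ (∀ t ∈ U, deriv g t ≠ 0) ∧ MapsTo g U V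

/-- Discontinuities visit singularities: there is `T₀ ≥ 1` such that every `c ∈ 𝒟 \ 𝒮` has some
`1 ≤ T ≤ T₀` for which `f^T(c)` is a point `s` of `𝒮`, for `0 < j < T` some point of `𝒟 \ 𝒮`
realizes the distance from `f^j(c)` to `𝒟`, and `f^T` is defined on some one-sided neighbourhood
of `c` and maps it diffeomorphically into a one-sided neighbourhood of `s`.
As usual `f^j(c)` is the one-sided limit of `f^j` at `c`. -/
def DiscontinuitiesVisitSingularities (f : ℝ → ℝ) (C : Finset ℝ) : Prop :=
  ∃ T₀ : ℕ, 1 ≤ T₀ ∧ ∀ c ∈ regularPoints f C, ∃ T : ℕ, 1 ≤ T ∧ T ≤ T₀ ∧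
    (∀ j : ℕ, 0 < j → j < T → ∃ y : ℝ, Tendsto f^[j] c.approach (𝓝 y) ∧
      ∃ c' ∈ regularPoints f C, Metric.infDist y (C : Set ℝ) = dist y c'.pos) ∧
    ∃ s ∈ singularPoints f C, Tendsto f^[T] c.approach (𝓝 s.pos) ∧
      ∃ ε > 0, ∃ δ > 0,
        (∀ t ∈ c.nbhd δ, ∀ j < T, f^[j] t ∈ I \ (C : Set ℝ)) ∧
        IsDiffeoInto f^[T] (c.nbhd δ) (s.nbhd ε)

/-- The smooth `δ`-truncated distance `d_δ(x, 𝒟)` of `x` to `𝒟`. -/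
def truncDist (C : Finset ℝ) (δ x : ℝ) : ℝ :=
  if Metric.infDist x (C : Set ℝ) ≤ δ then Metric.infDist x (C : Set ℝ)
  else if Metric.infDist x (C : Set ℝ) < 2 * δ then
    (1 - δ) / δ * Metric.infDist x (C : Set ℝ) + 2 * δ - 1
  else 1

/-- `Δ_δ(x) = |log d_δ(x, 𝒟)|`. Its value at the finitely many points `x ∈ C` is irrelevant: the
branches of `f` being injective, only countably many orbits meet `C`. -/
def logTruncDist (C : Finset ℝ) (δ x : ℝ) : ℝ := |Real.log (truncDist C δ x)|

/-- The set of `t ∈ I` with `(1/n) ∑_{j<n} Δ_δ(f^j(t)) > ε`. -/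
def badSet (f : ℝ → ℝ) (C : Finset ℝ) (δ ε : ℝ) (n : ℕ) : Set ℝ :=
  {t ∈ I | ε < (1 / (n : ℝ)) * ∑ j ∈ Finset.range n, logTruncDist C δ (f^[j] t)}

/-- Exponentially slow recurrence to `𝒟`: for each `ε > 0` there are `δ > 0` and `ξ > 0` with
`limsup (1/n) log λ {t ∈ I : (1/n) ∑_{j<n} Δ_δ(f^j(t)) > ε} < -ξ`.
The logarithm takes values in `[-∞, ∞]`, with `log 0 = -∞`. -/
def HasExponentiallySlowRecurrence (f : ℝ → ℝ) (C : Finset ℝ) : Prop :=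
  ∀ ε > 0, ∃ δ > 0, ∃ ξ > 0,
    limsup (fun n : ℕ ↦ ((1 / (n : ℝ) : ℝ) : EReal) * ENNReal.log (volume (badSet f C δ ε n)))
      atTop < ((-ξ : ℝ) : EReal)

end

end SlowRecurrence

/-!
Exponentially slow recurrence to the discontinuities of a piecewise expanding interval map.

Only singular points matter. Near a regular point `c` the visiting condition brings the orbit,
after `T` steps, close to a singular point `s`, with `|f^T t - s| ≤ K |t - c| ^ γ`; so each truncated
depth is at most a constant times the depths at singular points within the next `T₀` steps
(`exists_logTruncDist_le_sum`). Near a singular point the inverse branches contract by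
`|t - s| ^ (1 - β)`, which beats the weight `d ^ (-θ)` of an exponential moment of the depth
`log (1 / d)` when `2 θ ≤ 1 - β`.

The exponential moments over intervals `J` are bounded by `A |J| + B`, a form that one step of
the dynamics reproduces (`GrowthBound.step`). Where `f'` is uniformly continuous, the coefficient of
`|J|` grows by a factor close to `1` and `B` is contracted by `1 / σ`. Cutting `J` at finitely many
points costs a factor `2` in front of `B` and a multiple of `|J|`; this is affordable once every `N`
steps with `σ ^ N > 2`. The depth is only counted in a `δ`-zone of the singular points, and its
contribution to the `|J|` coefficient is absorbed by `B` when `δ` is small, so the moments grow at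
an arbitrarily small exponential rate (`exists_lintegral_orbitProd_le`).

The derivative may oscillate by a bounded factor at every scale near a singular point, so there is
no Hölder distortion control there. Each visit to a fixed `δ'`-zone is therefore penalized by a
constant `κ` that cancels this distortion. Orbits for which the total penalty matters visit the zone
with positive frequency; since there are at most `p ^ n` branches of `f ^ n`, while each visit
contracts by an arbitrarily small factor when `δ'` is small, these orbits form an exponentially
small set (`IsExpandingOff.lintegral_orbitProd_le`). Markov's inequality concludes
(`exists_volume_zoneDepth_le`).
-/

namespace SlowRecurrence
noncomputable section

/-! ### Expanding branches and change of variables -/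

/-- `f` maps `I \ C` into `I`, is differentiable there, and expands by a factor at least
`σ > 1`. This is all the measure estimates below need to know about the branches of `f`. -/
structure IsExpandingOff (f : ℝ → ℝ) (C : Finset ℝ) (σ : ℝ) : Prop where
  mapsTo : MapsTo f (I \ C) I
  differentiable : ∀ x ∈ I \ (C : Set ℝ), DifferentiableWithinAt ℝ f I x
  one_lt : 1 < σ
  le_abs_der : ∀ x ∈ I \ (C : Set ℝ), σ ≤ |der f x|

variable {f : ℝ → ℝ} {C : Finset ℝ} {σ : ℝ} {J : Set ℝ}

theorem IsExpandingOff.hasDerivWithinAt (h : IsExpandingOff f C σ) {x : ℝ}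
    (hx : x ∈ I \ (C : Set ℝ)) : HasDerivWithinAt f (der f x) I x :=
  (h.differentiable x hx).hasDerivWithinAt

theorem IsExpandingOff.continuousOn (h : IsExpandingOff f C σ) :
    ContinuousOn f (I \ C) := fun _ hx ↦
  ((h.hasDerivWithinAt hx).continuousWithinAt).mono sdiff_subset

theorem IsExpandingOff.injOn (h : IsExpandingOff f C σ) (hJ : J.OrdConnected)
    (hJC : J ⊆ I \ C) : InjOn f J := by
  have key : ∀ x ∈ J, ∀ y ∈ J, x < y → f x ≠ f y := by
    intro x hx y hy hxy hfxy
    have hsub : Icc x y ⊆ I \ C := (hJ.out hx hy).trans hJC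
    obtain ⟨c, hc, hc0⟩ := exists_hasDerivAt_eq_zero (f' := der f) hxy
      (h.continuousOn.mono hsub) hfxy (fun z hz ↦ by
        refine (h.hasDerivWithinAt (hsub (Ioo_subset_Icc_self hz))).hasDerivAt ?_
        exact Icc_mem_nhds ((hJC hx).1.1.trans_lt hz.1) (hz.2.trans_le (hJC hy).1.2))
    have := h.le_abs_der c (hsub (Ioo_subset_Icc_self hc))
    rw [hc0, abs_zero] at this
    linarith [h.one_lt]
  intro x hx y hy hxy
  rcases lt_trichotomy x y with hlt | heq | hlt
  · exact absurd hxy (key x hx y hy hlt)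
  · exact heq
  · exact absurd hxy.symm (key y hy x hx hlt)

theorem IsExpandingOff.ordConnected_image (h : IsExpandingOff f C σ) (hJ : J.OrdConnected)
    (hJC : J ⊆ I \ C) : (f '' J).OrdConnected :=
  (hJ.isPreconnected.image f (h.continuousOn.mono hJC)).ordConnected

theorem IsExpandingOff.image_subset (h : IsExpandingOff f C σ) (hJC : J ⊆ I \ C) :
    f '' J ⊆ I := (h.mapsTo.mono_left hJC).image_subset

theorem IsExpandingOff.lintegral_image (h : IsExpandingOff f C σ) (hJ : J.OrdConnected)
    (hJC : J ⊆ I \ C) (u : ℝ → ENNReal) :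
    ∫⁻ x in f '' J, u x = ∫⁻ x in J, ENNReal.ofReal |der f x| * u (f x) :=
  lintegral_image_eq_lintegral_abs_deriv_mul hJ.measurableSet
    (fun _ hx ↦ (h.hasDerivWithinAt (hJC hx)).mono (hJC.trans sdiff_subset))
    (h.injOn hJ hJC) u

theorem volume_ne_top_of_subset (hJ : J ⊆ I) : volume J ≠ ⊤ :=
  ne_top_of_le_ne_top (by simp) (measure_mono hJ)

theorem IsExpandingOff.volume_image_le (h : IsExpandingOff f C σ) (hJ : J.OrdConnected)
    (hJC : J ⊆ I \ C) {M : ℝ} (hM : ∀ x ∈ J, |der f x| ≤ M) (hM0 : 0 ≤ M) :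
    volume.real (f '' J) ≤ M * volume.real J := by
  have hfin := volume_ne_top_of_subset (hJC.trans sdiff_subset)
  have : volume (f '' J) ≤ ENNReal.ofReal M * volume J := by
    have h1 := h.lintegral_image hJ hJC 1
    simp only [Pi.one_apply, lintegral_const, one_mul, mul_one, Measure.restrict_apply,
      MeasurableSet.univ, univ_inter] at h1
    rw [h1, ← setLIntegral_const]
    exact setLIntegral_mono' hJ.measurableSet
      fun x hx ↦ ENNReal.ofReal_le_ofReal (hM x hx)
  have h2 := ENNReal.toReal_mono (ENNReal.mul_ne_top ENNReal.ofReal_ne_top hfin) this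
  rwa [ENNReal.toReal_mul, ENNReal.toReal_ofReal hM0] at h2

/-- One step of the dynamics: a bound `A |·| + B` for the integrals of `u` over the image of `J`
pulls back to a bound of the same shape, with the coefficients changed by the distortion `M / m`
and by the contraction `1 / m` of the inverse branch. -/
theorem IsExpandingOff.lintegral_mul_comp_le (h : IsExpandingOff f C σ) (hJ : J.OrdConnected)
    (hJC : J ⊆ I \ C) {m M v A B : ℝ} (hm : 0 < m) (hv : 0 ≤ v) (hA : 0 ≤ A)
    (hder : ∀ x ∈ J, m ≤ |der f x| ∧ |der f x| ≤ M) {ψ u : ℝ → ENNReal}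
    (hψ : ∀ x ∈ J, ψ x ≤ ENNReal.ofReal v)
    (hu : ∫⁻ x in f '' J, u x ≤ ENNReal.ofReal (A * volume.real (f '' J) + B)) :
    ∫⁻ x in J, ψ x * u (f x) ≤ ENNReal.ofReal (v / m * (A * M * volume.real J + B)) := by
  rcases J.eq_empty_or_nonempty with rfl | ⟨x₀, hx₀⟩
  · simp
  have hM0 : 0 ≤ M := hm.le.trans ((hder x₀ hx₀).1.trans (hder x₀ hx₀).2)
  have hvol := h.volume_image_le hJ hJC (fun x hx ↦ (hder x hx).2) hM0
  have hvm : 0 ≤ v / m := by positivity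
  calc ∫⁻ x in J, ψ x * u (f x)
      ≤ ∫⁻ x in J, ENNReal.ofReal (v / m) * (ENNReal.ofReal |der f x| * u (f x)) := by
        refine setLIntegral_mono' hJ.measurableSet fun x hx ↦ ?_
        rw [← mul_assoc, ← ENNReal.ofReal_mul hvm]
        gcongr
        refine (hψ x hx).trans (ENNReal.ofReal_le_ofReal ?_)
        calc v = v / m * m := by field_simp
          _ ≤ _ := by gcongr; exact (hder x hx).1
    _ = ENNReal.ofReal (v / m) * ∫⁻ x in f '' J, u x := by
        rw [lintegral_const_mul' _ _ ENNReal.ofReal_ne_top, h.lintegral_image hJ hJC]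
    _ ≤ ENNReal.ofReal (v / m) * ENNReal.ofReal (A * volume.real (f '' J) + B) := by gcongr
    _ = ENNReal.ofReal (v / m * (A * volume.real (f '' J) + B)) :=
        (ENNReal.ofReal_mul hvm).symm
    _ ≤ _ := by
        refine ENNReal.ofReal_le_ofReal ?_
        rw [mul_assoc A]
        gcongr

/-! ### Cutting intervals at finitely many points -/

/-- A bound `A |·| + B` on the subintervals that avoid a finite set costs, on a whole interval,
only a constant factor in front of `B`. -/
theorem lintegral_le_of_avoiding (F : Finset ℝ) {u : ℝ → ENNReal} {A B : ℝ} (hA : 0 ≤ A)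
    (hB : 0 ≤ B) : ∀ J : Set ℝ, J.OrdConnected → J ⊆ I →
      (∀ J' ⊆ J, J'.OrdConnected → J' ⊆ I \ F →
        ∫⁻ x in J', u x ≤ ENNReal.ofReal (A * volume.real J' + B)) →
      ∫⁻ x in J, u x ≤ ENNReal.ofReal (A * volume.real J + 2 ^ F.card * B) := by
  induction F using Finset.induction_on with
  | empty =>
    intro J hJ hJI h
    simpa using h J subset_rfl hJ (by simpa using hJI)
  | insert c F hc ih =>
    intro J hJ hJI h
    have hl : (J ∩ Iio c).OrdConnected := hJ.inter ordConnected_Iio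
    have hr : (J ∩ Ioi c).OrdConnected := hJ.inter ordConnected_Ioi
    have h1 := ih (J ∩ Iio c) hl (inter_subset_left.trans hJI) fun J' hJ' ho hF ↦
      h J' (hJ'.trans inter_subset_left) ho fun x hx ↦ ⟨(hF hx).1, by
        have h1 := (hF hx).2
        have h2 : x ≠ c := ne_of_lt (hJ' hx).2
        simp_all⟩
    have h2 := ih (J ∩ Ioi c) hr (inter_subset_left.trans hJI) fun J' hJ' ho hF ↦
      h J' (hJ'.trans inter_subset_left) ho fun x hx ↦ ⟨(hF hx).1, by
        have h1 := (hF hx).2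
        have h2 : x ≠ c := ne_of_gt (hJ' hx).2
        simp_all⟩
    have hsub : J ⊆ (J ∩ Iio c ∪ J ∩ Ioi c) ∪ {c} := by
      intro x hx
      rcases lt_trichotomy x c with h | h | h <;> simp [hx, h]
    have hvol : volume.real (J ∩ Iio c) + volume.real (J ∩ Ioi c) ≤ volume.real J := by
      rw [← measureReal_union (by
        rw [Set.disjoint_left]; rintro x ⟨_, h1⟩ ⟨_, h2⟩
        exact lt_asymm (mem_Iio.1 h1) (mem_Ioi.1 h2)) hr.measurableSet
        (volume_ne_top_of_subset (inter_subset_left.trans hJI))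
        (volume_ne_top_of_subset (inter_subset_left.trans hJI))]
      exact measureReal_mono (union_subset inter_subset_left inter_subset_left)
        (volume_ne_top_of_subset hJI)
    calc ∫⁻ x in J, u x ≤ ∫⁻ x in (J ∩ Iio c ∪ J ∩ Ioi c) ∪ {c}, u x := lintegral_mono_set hsub
      _ ≤ (∫⁻ x in J ∩ Iio c, u x) + (∫⁻ x in J ∩ Ioi c, u x) + 0 := by
          refine (lintegral_union_le _ _ _).trans ?_
          gcongr
          · exact lintegral_union_le _ _ _
          · simp
      _ ≤ _ := by
          rw [add_zero]
          refine (add_le_add h1 h2).trans ?_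
          rw [← ENNReal.ofReal_add (by positivity) (by positivity)]
          refine ENNReal.ofReal_le_ofReal ?_
          rw [Finset.card_insert_of_notMem hc, pow_succ]
          nlinarith

/-- The points of a finite set are separated by a definite gap. -/
theorem exists_gap (F : Finset ℝ) : ∃ r > 0, ∀ x ∈ F, ∀ y ∈ F, x < y → r < y - x := by
  have hgap : ∀ᶠ r in 𝓝[>] (0 : ℝ), ∀ x ∈ F, ∀ y ∈ F, x < y → r < y - x := by
    refine (Filter.eventually_all_finset F).2 fun x _ ↦
      (Filter.eventually_all_finset F).2 fun y _ ↦ ?_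
    by_cases hxy : x < y
    · filter_upwards [Ioo_mem_nhdsGT (sub_pos.2 hxy)] with r hr _ using hr.2
    · exact Eventually.of_forall fun r h ↦ absurd h hxy
  obtain ⟨r, hr, hr0⟩ := (hgap.and self_mem_nhdsWithin).exists
  exact ⟨r, hr0, hr⟩

/-- Cutting along a finite set, with uniform control of the cost: an interval shorter than the
gaps of `F` meets at most one point of `F` and is cut in two, whereas a longer one pays for
its pieces with its length. -/
theorem exists_lintegral_le_of_avoiding (F : Finset ℝ) : ∃ R : ℝ, 0 ≤ R ∧
    ∀ (u : ℝ → ENNReal) (A B : ℝ), 0 ≤ A → 0 ≤ B →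
      (∀ J : Set ℝ, J.OrdConnected → J ⊆ I \ F →
        ∫⁻ x in J, u x ≤ ENNReal.ofReal (A * volume.real J + B)) →
      ∀ J : Set ℝ, J.OrdConnected → J ⊆ I →
        ∫⁻ x in J, u x ≤ ENNReal.ofReal ((A + R * B) * volume.real J + 2 * B) := by
  obtain ⟨r, hr0, hr⟩ := exists_gap F
  refine ⟨2 ^ F.card / r, by positivity, fun u A B hA hB h J hJ hJI ↦ ?_⟩
  have hfin := volume_ne_top_of_subset hJI
  rcases lt_or_ge (volume.real J) r with hlt | hge
  · -- At most one point of `F` lies in `J`.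
    obtain ⟨G, hG1, hG2⟩ : ∃ G : Finset ℝ, G.card ≤ 1 ∧ ∀ x ∈ J, x ∈ F → x ∈ G := by
      by_cases hne : ∃ x ∈ J, x ∈ F
      · obtain ⟨x, hxJ, hxF⟩ := hne
        have key : ∀ x ∈ J, x ∈ F → ∀ y ∈ J, y ∈ F → ¬ x < y := by
          intro x hxJ hxF y hyJ hyF hxy
          have h1 := measureReal_mono (μ := volume) (hJ.out hxJ hyJ) hfin
          rw [Real.volume_real_Icc_of_le hxy.le] at h1
          linarith [hr x hxF y hyF hxy]
        refine ⟨{x}, by simp, fun y hyJ hyF ↦ Finset.mem_singleton.2 ?_⟩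
        exact le_antisymm (not_lt.1 (key x hxJ hxF y hyJ hyF))
          (not_lt.1 (key y hyJ hyF x hxJ hxF))
      · exact ⟨∅, by simp, fun x hx hxF ↦ (hne ⟨x, hx, hxF⟩).elim⟩
    refine (lintegral_le_of_avoiding G hA hB J hJ hJI fun J' hJ' ho hG ↦
      h J' ho fun x hx ↦ ⟨(hG hx).1, fun hxF ↦ (hG hx).2 (hG2 x (hJ' hx) hxF)⟩).trans
      (ENNReal.ofReal_le_ofReal ?_)
    have : (2 : ℝ) ^ G.card ≤ 2 ^ 1 := pow_le_pow_right₀ (by norm_num) hG1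
    have h3 : 0 ≤ 2 ^ F.card / r * B * volume.real J := by positivity
    nlinarith
  · refine (lintegral_le_of_avoiding F hA hB J hJ hJI fun J' _ ho hF ↦ h J' ho hF).trans
      (ENNReal.ofReal_le_ofReal ?_)
    have : 2 ^ F.card * B ≤ 2 ^ F.card / r * B * volume.real J := by
      calc 2 ^ F.card * B = 2 ^ F.card / r * B * r := by field_simp
        _ ≤ _ := by gcongr
    nlinarith

/-- Finiteness of a set can be checked on the intervals that avoid a finite set. -/
theorem finite_inter_of_avoiding (F : Finset ℝ) {X : Set ℝ} : ∀ J : Set ℝ, J.OrdConnected →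
    (∀ J' ⊆ J, J'.OrdConnected → Disjoint J' F → (J' ∩ X).Finite) → (J ∩ X).Finite := by
  induction F using Finset.induction_on with
  | empty => exact fun J hJ h ↦ h J subset_rfl hJ (by simp)
  | insert c F hc ih =>
    intro J hJ h
    have h1 := ih (J ∩ Iio c) (hJ.inter ordConnected_Iio) fun J' hJ' ho hF ↦
      h J' (hJ'.trans inter_subset_left) ho (by
        rw [Finset.coe_insert, Set.disjoint_insert_right]
        exact ⟨fun hx ↦ lt_irrefl c (hJ' hx).2, hF⟩)
    have h2 := ih (J ∩ Ioi c) (hJ.inter ordConnected_Ioi) fun J' hJ' ho hF ↦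
      h J' (hJ'.trans inter_subset_left) ho (by
        rw [Finset.coe_insert, Set.disjoint_insert_right]
        exact ⟨fun hx ↦ lt_irrefl c (hJ' hx).2, hF⟩)
    refine ((h1.union h2).union (finite_singleton c)).subset fun x hx ↦ ?_
    rcases lt_trichotomy x c with h | h | h <;> simp [hx.1, hx.2, h]

theorem IsExpandingOff.finite_preimage (h : IsExpandingOff f C σ) {X : Set ℝ} (hX : X.Finite) :
    (I ∩ {x | x ∉ C ∧ f x ∈ X}).Finite := by
  refine finite_inter_of_avoiding C I ordConnected_Icc fun J hJ ho hC ↦ ?_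
  refine Set.Finite.of_finite_image (f := f) (hX.subset ?_) ?_
  · rintro _ ⟨x, hx, rfl⟩
    exact hx.2.2
  · exact (h.injOn ho fun x hx ↦ ⟨hJ hx, fun hxC ↦ Set.disjoint_left.1 hC hx hxC⟩).mono
      inter_subset_left

/-! ### Orbits -/

/-- The map `f` with its values off `I \ C`, which are arbitrary, replaced by `0`: a measurable
self-map of `I`. -/
def branchMap (f : ℝ → ℝ) (C : Finset ℝ) : ℝ → ℝ := indicator (I \ C) f

theorem branchMap_of_mem {x : ℝ} (hx : x ∈ I \ (C : Set ℝ)) : branchMap f C x = f x :=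
  indicator_of_mem hx f

theorem IsExpandingOff.branchMap_mem (h : IsExpandingOff f C σ) (x : ℝ) :
    branchMap f C x ∈ I := by
  by_cases hx : x ∈ I \ (C : Set ℝ)
  · rw [branchMap_of_mem hx]; exact h.mapsTo hx
  · rw [branchMap, indicator_of_notMem hx]; simp

theorem IsExpandingOff.iterate_mem (h : IsExpandingOff f C σ) {x : ℝ} (hx : x ∈ I) (n : ℕ) :
    (branchMap f C)^[n] x ∈ I := by
  cases n with
  | zero => exact hx
  | succ n => rw [Function.iterate_succ_apply']; exact h.branchMap_mem _

theorem IsExpandingOff.measurable_branchMap (h : IsExpandingOff f C σ) :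
    Measurable (branchMap f C) := by
  classical
  have hm : MeasurableSet (I \ (C : Set ℝ)) := measurableSet_Icc.diff C.measurableSet
  have := h.continuousOn.measurable_piecewise (g := fun _ ↦ (0 : ℝ)) continuousOn_const hm
  rwa [show (fun _ : ℝ ↦ (0 : ℝ)) = 0 from rfl, piecewise_eq_indicator] at this

theorem iterate_eq_branchMap_iterate {x : ℝ} {n : ℕ}
    (h : ∀ j < n, (branchMap f C)^[j] x ∈ I \ (C : Set ℝ)) :
    f^[n] x = (branchMap f C)^[n] x := by
  induction n with
  | zero => rfl
  | succ n ih =>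
    rw [Function.iterate_succ_apply', Function.iterate_succ_apply',
      ih fun j hj ↦ h j (hj.trans n.lt_succ_self), branchMap_of_mem (h n n.lt_succ_self)]

theorem IsExpandingOff.finite_iterate_preimage (h : IsExpandingOff f C σ) {X : Set ℝ}
    (hX : X.Finite) (n : ℕ) : {x ∈ I | (branchMap f C)^[n] x ∈ X}.Finite := by
  induction n with
  | zero => exact hX.subset fun x hx ↦ hx.2
  | succ n ih =>
    refine ((h.finite_preimage ih).union C.finite_toSet).subset ?_
    rintro x ⟨hxI, hx⟩
    by_cases hxC : x ∈ C
    · exact Or.inr hxC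
    · refine Or.inl ⟨hxI, hxC, h.mapsTo ⟨hxI, hxC⟩, ?_⟩
      rw [Function.iterate_succ_apply, branchMap_of_mem ⟨hxI, hxC⟩] at hx
      exact hx

end

noncomputable section

/-! ### Singular zones -/

variable {f : ℝ → ℝ} {C : Finset ℝ} {σ : ℝ} {J : Set ℝ} {S : Set OneSidedPoint}
  {K θ δ₀ : ℝ}

theorem OneSidedPoint.abs_sub_of_mem_nbhd {c : OneSidedPoint} {δ x : ℝ} (hx : x ∈ c.nbhd δ) :
    0 < |x - c.pos| ∧ |x - c.pos| < δ := by
  rcases c with ⟨p, _ | _⟩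
  · obtain ⟨h1, h2⟩ : p - δ < x ∧ x < p := hx
    simp only
    rw [abs_of_neg (by linarith)]
    constructor <;> linarith
  · obtain ⟨h1, h2⟩ : p < x ∧ x < p + δ := hx
    simp only
    rw [abs_of_pos (by linarith)]
    constructor <;> linarith

theorem OneSidedPoint.nbhd_mono {c : OneSidedPoint} {δ δ' : ℝ} (h : δ ≤ δ') :
    c.nbhd δ ⊆ c.nbhd δ' := by
  rcases c with ⟨p, _ | _⟩
  · exact Ioo_subset_Ioo_left (by simp only; linarith)
  · exact Ioo_subset_Ioo_right (by simp only; linarith)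

theorem OneSidedPoint.isOpen_nbhd (c : OneSidedPoint) (δ : ℝ) : IsOpen (c.nbhd δ) := by
  rcases c with ⟨p, _ | _⟩ <;> exact isOpen_Ioo

theorem OneSidedPoint.mem_nbhd_of_abs_lt {c : OneSidedPoint} {δ δ' x : ℝ} (hx : x ∈ c.nbhd δ)
    (h : |x - c.pos| < δ') : x ∈ c.nbhd δ' := by
  rcases c with ⟨p, _ | _⟩
  · obtain ⟨h1, h2⟩ : p - δ < x ∧ x < p := hx
    exact ⟨by simp only at *; linarith [(abs_lt.1 h).1], h2⟩
  · obtain ⟨h1, h2⟩ : p < x ∧ x < p + δ := hx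
    exact ⟨h1, by simp only at *; linarith [(abs_lt.1 h).2]⟩

/-- The part of an interval on one side of `c` at distance in `(a, b]` from `c` is an interval. -/
theorem OneSidedPoint.ordConnected_inter_ring {c : OneSidedPoint} {δ : ℝ} (hJ : J.OrdConnected)
    (hJc : J ⊆ c.nbhd δ) (a b : ℝ) :
    (J ∩ (fun x ↦ |x - c.pos|) ⁻¹' Ioc a b).OrdConnected := by
  refine ⟨fun x hx y hy z hz ↦ ⟨hJ.out hx.1 hy.1 hz, ?_⟩⟩
  have hzJ := hJc (hJ.out hx.1 hy.1 hz)
  have hxJ := hJc hx.1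
  have hyJ := hJc hy.1
  have hx2 : a < |x - c.pos| ∧ |x - c.pos| ≤ b := hx.2
  have hy2 : a < |y - c.pos| ∧ |y - c.pos| ≤ b := hy.2
  obtain ⟨hz1, hz2⟩ := hz
  show a < |z - c.pos| ∧ |z - c.pos| ≤ b
  rcases c with ⟨p, _ | _⟩
  · obtain ⟨-, h1⟩ : p - δ < x ∧ x < p := hxJ
    obtain ⟨-, h2⟩ : p - δ < y ∧ y < p := hyJ
    obtain ⟨-, h3⟩ : p - δ < z ∧ z < p := hzJ
    simp only at *
    rw [abs_of_neg (by linarith)] at *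
    constructor <;> linarith
  · obtain ⟨h1, -⟩ : p < x ∧ x < p + δ := hxJ
    obtain ⟨h2, -⟩ : p < y ∧ y < p + δ := hyJ
    obtain ⟨h3, -⟩ : p < z ∧ z < p + δ := hzJ
    simp only at *
    rw [abs_of_pos (by linarith)] at *
    constructor <;> linarith

/-- The union of the one-sided `δ`-neighbourhoods of the points of `S`. -/
def zone (S : Set OneSidedPoint) (δ : ℝ) : Set ℝ := ⋃ s ∈ S, s.nbhd δ

theorem zone_mono {δ δ' : ℝ} (h : δ ≤ δ') : zone S δ ⊆ zone S δ' :=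
  iUnion₂_mono fun _ _ ↦ OneSidedPoint.nbhd_mono h

theorem measurableSet_zone (S : Set OneSidedPoint) (δ : ℝ) : MeasurableSet (zone S δ) :=
  (isOpen_biUnion fun s _ ↦ s.isOpen_nbhd δ).measurableSet

/-- All points of `S` are singular, with uniform constants: near `s ∈ S` the derivative is of
size `|t - s| ^ (β - 1)` with `1 - β ≥ 2 θ`, and `s` is the point of `C` closest to `t`. -/
structure IsUniformlySingular (f : ℝ → ℝ) (C : Finset ℝ) (S : Set OneSidedPoint)
    (K θ δ₀ : ℝ) : Prop where
  one_le : 1 ≤ K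
  theta_pos : 0 < θ
  le_one : δ₀ ≤ 1
  order : ∀ s ∈ S, ∃ β : ℝ, 0 < β ∧ 2 * θ ≤ 1 - β ∧ ∀ t ∈ s.nbhd δ₀,
    K⁻¹ * |t - s.pos| ^ (β - 1) ≤ |der f t| ∧ |der f t| ≤ K * |t - s.pos| ^ (β - 1)
  infDist_eq : ∀ s ∈ S, ∀ t ∈ s.nbhd δ₀, Metric.infDist t (C : Set ℝ) = |t - s.pos|

/-- The weight of a point in the exponential moment: nothing outside the `δ'`-zone of `S`, a
penalty `κ` inside it, which is to absorb the distortion `2 K ^ 2` of `f` on dyadic rings, and in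
the smaller `δ`-zone moreover the exponential `d ^ (-θ)` of the recurrence depth. -/
def depthWeight (C : Finset ℝ) (S : Set OneSidedPoint) (κ θ δ' δ x : ℝ) : ENNReal :=
  open Classical in
  if x ∈ zone S δ' then
    ENNReal.ofReal (κ * if x ∈ zone S δ then Metric.infDist x (C : Set ℝ) ^ (-θ) else 1)
  else 1

theorem measurable_depthWeight (C : Finset ℝ) (S : Set OneSidedPoint) (κ θ δ' δ : ℝ) :
    Measurable (depthWeight C S κ θ δ' δ) := by
  refine Measurable.ite (measurableSet_zone S δ') ?_ measurable_const
  refine ENNReal.measurable_ofReal.comp (measurable_const.mul ?_)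
  refine Measurable.ite (measurableSet_zone S δ) ?_ measurable_const
  exact (Metric.continuous_infDist_pt (C : Set ℝ)).measurable.pow_const _

/-- The contribution of one dyadic ring `r / 2 < |x - s| ≤ r` around a singular point:
besides `A |J|` it consists of powers of the radius `r`, which are summable over all rings. -/
theorem IsUniformlySingular.lintegral_ring_le (h : IsExpandingOff f C σ)
    (hS : IsUniformlySingular f C S K θ δ₀) {s : OneSidedPoint} (hs : s ∈ S) {r δ' δ : ℝ}
    (hr : 0 < r) (hr1 : r ≤ 1) (hδ : 0 < δ) (hδ' : δ' ≤ δ₀)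
    (hJ : J.OrdConnected) (hJC : J ⊆ I \ C) (hJs : J ⊆ s.nbhd δ')
    (hJr : ∀ x ∈ J, r / 2 < |x - s.pos| ∧ |x - s.pos| ≤ r) {u : ℝ → ENNReal} {A B : ℝ}
    (hA : 0 ≤ A) (hB : 0 ≤ B)
    (hu : ∫⁻ x in f '' J, u x ≤ ENNReal.ofReal (A * volume.real (f '' J) + B)) :
    ∫⁻ x in J, depthWeight C S (1 / (2 * K ^ 2)) θ δ' δ x * u (f x) ≤
      ENNReal.ofReal (A * volume.real J + 4 * (2 * δ) ^ (θ / 2) * A * r ^ (θ / 2) +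
        2 * K * B * r ^ θ) := by
  obtain ⟨β, hβ, hβθ, hord⟩ := hS.order s hs
  have hK := hS.one_le
  have hθ := hS.theta_pos
  have hK0 : 0 < K := by linarith
  set κ := 1 / (2 * K ^ 2) with hκ
  have hκ0 : 0 < κ := by positivity
  have hκ1 : κ ≤ 1 := by
    rw [hκ, div_le_one (by positivity)]; nlinarith
  set w : ℝ := if r / 2 < δ then (r / 2) ^ (-θ) else 1 with hw
  have hw0 : 0 ≤ w := by rw [hw]; split_ifs <;> positivity
  -- The volume of the ring is at most `2 r`.
  have hvol : volume.real J ≤ 2 * r := by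
    have : J ⊆ Metric.closedBall s.pos r := fun x hx ↦ by
      rw [Metric.mem_closedBall, Real.dist_eq]; exact (hJr x hx).2
    have := measureReal_mono (μ := volume) this (by
      rw [Real.volume_closedBall]; exact ENNReal.ofReal_ne_top)
    rwa [measureReal_def volume (Metric.closedBall _ _), Real.volume_closedBall,
      ENNReal.toReal_ofReal (by linarith)] at this
  have hvol0 : 0 ≤ volume.real J := measureReal_nonneg
  have hone := h.lintegral_mul_comp_le hJ hJC (m := K⁻¹ * r ^ (β - 1))
    (M := 2 * K * r ^ (β - 1)) (v := κ * w) (A := A) (B := B)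
    (ψ := depthWeight C S κ θ δ' δ) (u := u)
    (by positivity) (by positivity) hA (fun x hx ↦ ?_) (fun x hx ↦ ?_) hu
  · refine hone.trans (ENNReal.ofReal_le_ofReal ?_)
    have hrp : 0 < r ^ (β - 1) := by positivity
    have hinv : (r ^ (β - 1))⁻¹ = r ^ (1 - β) := by
      rw [← Real.rpow_neg hr.le]; ring_nf
    have e1 : κ * w / (K⁻¹ * r ^ (β - 1)) * (A * (2 * K * r ^ (β - 1)) * volume.real J + B) =
        w * (A * volume.real J) + w * (κ * K * r ^ (1 - β) * B) := by
      rw [← hinv, hκ]; field_simp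
    rw [e1]
    have hBterm : r ^ (1 - β) ≤ r ^ θ * r ^ θ := by
      rw [← Real.rpow_add hr]
      exact Real.rpow_le_rpow_of_exponent_ge hr hr1 (by linarith)
    have hrθ0 : 0 < r ^ θ := by positivity
    have hrθ1 : r ^ θ ≤ 1 := Real.rpow_le_one hr.le hr1 hθ.le
    rw [hw]
    split_ifs with hcase
    · have hw2 : (r / 2) ^ (-θ) ≤ 2 * (r ^ θ)⁻¹ := by
        rw [Real.div_rpow hr.le (by norm_num), Real.rpow_neg hr.le, Real.rpow_neg (by norm_num),
          div_inv_eq_mul, mul_comm]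
        gcongr
        calc (2 : ℝ) ^ θ ≤ 2 ^ (1 : ℝ) :=
              Real.rpow_le_rpow_of_exponent_le (by norm_num) (by linarith)
          _ = 2 := Real.rpow_one 2
      have hA1 : (r / 2) ^ (-θ) * (A * volume.real J) ≤
          4 * (2 * δ) ^ (θ / 2) * A * r ^ (θ / 2) := by
        have e2 : r ≤ r ^ θ * r ^ θ := by
          rw [← Real.rpow_add hr]
          calc r = r ^ (1 : ℝ) := (Real.rpow_one r).symm
            _ ≤ _ := Real.rpow_le_rpow_of_exponent_ge hr hr1 (by linarith)
        have e3 : r ^ θ ≤ (2 * δ) ^ (θ / 2) * r ^ (θ / 2) := by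
          calc r ^ θ = r ^ (θ / 2) * r ^ (θ / 2) := by
                rw [← Real.rpow_add hr]; ring_nf
            _ ≤ _ := by
              gcongr
              linarith
        calc (r / 2) ^ (-θ) * (A * volume.real J)
            ≤ 2 * (r ^ θ)⁻¹ * (A * (2 * (r ^ θ * r ^ θ))) := by
              gcongr
              linarith
          _ = 4 * A * r ^ θ := by field_simp; ring
          _ ≤ 4 * A * ((2 * δ) ^ (θ / 2) * r ^ (θ / 2)) := by gcongr
          _ = _ := by ring
      have hB1 : (r / 2) ^ (-θ) * (κ * K * r ^ (1 - β) * B) ≤ 2 * K * B * r ^ θ := by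
        calc (r / 2) ^ (-θ) * (κ * K * r ^ (1 - β) * B)
            ≤ 2 * (r ^ θ)⁻¹ * (1 * K * (r ^ θ * r ^ θ) * B) := by gcongr
          _ = _ := by field_simp
      have : 0 ≤ A * volume.real J := by positivity
      linarith
    · have hB1 : κ * K * r ^ (1 - β) * B ≤ 2 * K * B * r ^ θ := by
        calc κ * K * r ^ (1 - β) * B ≤ 1 * K * (1 * r ^ θ) * B := by
              gcongr
              exact hBterm.trans (by gcongr)
          _ ≤ _ := by
              have : 0 ≤ K * B * r ^ θ := by positivity
              linarith
      have : 0 ≤ 4 * (2 * δ) ^ (θ / 2) * A * r ^ (θ / 2) := by positivity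
      linarith
  · have hx0 : 0 < |x - s.pos| := (OneSidedPoint.abs_sub_of_mem_nbhd (hJs hx)).1
    obtain ⟨hlo, hhi⟩ := hord x (OneSidedPoint.nbhd_mono hδ' (hJs hx))
    obtain ⟨hr2, hr3⟩ := hJr x hx
    constructor
    · refine le_trans ?_ hlo
      gcongr ?_ * ?_
      exact Real.rpow_le_rpow_of_nonpos hx0 hr3 (by linarith)
    · refine hhi.trans ?_
      rw [mul_assoc, mul_left_comm]
      gcongr
      calc |x - s.pos| ^ (β - 1) ≤ (r / 2) ^ (β - 1) :=
            Real.rpow_le_rpow_of_nonpos (by positivity) hr2.le (by linarith)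
        _ = 2 ^ (1 - β) * r ^ (β - 1) := by
            rw [Real.div_rpow hr.le (by norm_num), div_eq_mul_inv, ← Real.rpow_neg (by norm_num),
              mul_comm]
            ring_nf
        _ ≤ 2 ^ (1 : ℝ) * r ^ (β - 1) := by
            gcongr
            · norm_num
            · linarith
        _ = _ := by rw [Real.rpow_one]
  · obtain ⟨hr2, hr3⟩ := hJr x hx
    have hxz : x ∈ zone S δ' := mem_biUnion hs (hJs hx)
    rw [depthWeight, if_pos hxz]
    refine ENNReal.ofReal_le_ofReal (mul_le_mul_of_nonneg_left ?_ hκ0.le)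
    have hd : Metric.infDist x (C : Set ℝ) = |x - s.pos| :=
      hS.infDist_eq s hs x (OneSidedPoint.nbhd_mono hδ' (hJs hx))
    have hbig : 1 ≤ (r / 2) ^ (-θ) :=
      Real.one_le_rpow_of_pos_of_le_one_of_nonpos (by positivity) (by linarith) (by linarith)
    split_ifs with hxδ
    · have hdδ : |x - s.pos| < δ := by
        obtain ⟨t, ht, hxt⟩ := mem_iUnion₂.1 hxδ
        rcases lt_or_ge δ δ₀ with hlt | hge
        · rw [← hd, hS.infDist_eq t ht x (OneSidedPoint.nbhd_mono hlt.le hxt)]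
          exact (OneSidedPoint.abs_sub_of_mem_nbhd hxt).2
        · exact (OneSidedPoint.abs_sub_of_mem_nbhd (hJs hx)).2.trans_le (hδ'.trans hge)
      rw [hw, if_pos (hr2.trans hdδ), hd]
      exact Real.rpow_le_rpow_of_nonpos (by positivity) hr2.le (by linarith)
    · rw [hw]
      split_ifs
      · exact hbig
      · exact le_rfl

/-- Passing through the zone of a singular point: the sum over all dyadic rings. The penalty in
the weight cancels the distortion, so the coefficient of the length does not grow. -/
theorem IsUniformlySingular.lintegral_nbhd_le (h : IsExpandingOff f C σ)
    (hS : IsUniformlySingular f C S K θ δ₀) {s : OneSidedPoint} (hs : s ∈ S) {δ' δ ρ τ : ℝ}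
    (hδ : 0 < δ) (hδ'0 : 0 < δ') (hδ' : δ' ≤ δ₀)
    (hρ : 2 * K * (δ' ^ θ * (1 - (1 / 2) ^ θ)⁻¹) ≤ ρ)
    (hτ : 4 * (2 * δ) ^ (θ / 2) * (1 - (1 / 2) ^ (θ / 2))⁻¹ ≤ τ)
    (hJ : J.OrdConnected) (hJC : J ⊆ I \ C) (hJs : J ⊆ s.nbhd δ')
    {u : ℝ → ENNReal} {A B : ℝ} (hA : 0 ≤ A) (hB : 0 ≤ B)
    (hu : ∀ J' ⊆ J, J'.OrdConnected →
      ∫⁻ x in f '' J', u x ≤ ENNReal.ofReal (A * volume.real (f '' J') + B)) :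
    ∫⁻ x in J, depthWeight C S (1 / (2 * K ^ 2)) θ δ' δ x * u (f x) ≤
      ENNReal.ofReal (A * volume.real J + (ρ * B + τ * A)) := by
  have hθ := hS.theta_pos
  have hK0 : 0 < K := by linarith [hS.one_le]
  set r : ℕ → ℝ := fun k ↦ δ' * (1 / 2) ^ k with hr
  have hr0 : ∀ k, 0 < r k := fun k ↦ by positivity
  have hr1 : ∀ k, r k ≤ 1 := fun k ↦ mul_le_one₀ (hδ'.trans hS.le_one) (by positivity)
    (pow_le_one₀ (by norm_num) (by norm_num))
  have hanti : Antitone r := fun i j hij ↦ by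
    simp only [hr]
    gcongr ?_ * ?_
    exact pow_le_pow_of_le_one (by norm_num) (by norm_num) hij
  set R : ℕ → Set ℝ := fun k ↦ J ∩ (fun x ↦ |x - s.pos|) ⁻¹' Ioc (r (k + 1)) (r k) with hR
  have hRJ : ∀ k, R k ⊆ J := fun k ↦ inter_subset_left
  have hRo : ∀ k, (R k).OrdConnected := fun k ↦
    OneSidedPoint.ordConnected_inter_ring hJ hJs _ _
  have hcover : J ⊆ ⋃ k, R k := by
    intro x hx
    obtain ⟨h0, h1⟩ := OneSidedPoint.abs_sub_of_mem_nbhd (hJs hx)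
    obtain ⟨k, hk1, hk2⟩ := exists_nat_pow_near_of_lt_one (x := |x - s.pos| / δ')
      (y := 1 / 2) (by positivity) ((div_le_one hδ'0).2 h1.le) (by norm_num) (by norm_num)
    refine mem_iUnion.2 ⟨k, hx, ?_, ?_⟩
    · simp only [hr]
      rwa [lt_div_iff₀ hδ'0, mul_comm] at hk1
    · simp only [hr]
      rwa [div_le_iff₀ hδ'0, mul_comm] at hk2
  have hdisj : Pairwise (Function.onFun Disjoint R) := by
    intro i j hij
    have := (hanti.pairwise_disjoint_on_Ioc_succ hij).preimage (fun x ↦ |x - s.pos|)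
    exact this.mono inter_subset_right inter_subset_right
  have hfin := volume_ne_top_of_subset (hJC.trans sdiff_subset)
  -- The lengths of the rings add up to at most the length of `J`.
  have hvol : ∑' k, ENNReal.ofReal (A * volume.real (R k)) ≤
      ENNReal.ofReal (A * volume.real J) := by
    have e : ∀ T ⊆ J, ENNReal.ofReal (A * volume.real T) = ENNReal.ofReal A * volume T := by
      intro T hT
      rw [ENNReal.ofReal_mul hA, ofReal_measureReal (ne_top_of_le_ne_top hfin (measure_mono hT))]
    rw [e J subset_rfl]
    simp_rw [fun k ↦ e (R k) (hRJ k)]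
    rw [ENNReal.tsum_mul_left]
    gcongr
    exact (tsum_meas_le_meas_iUnion_of_disjoint _ (fun k ↦ (hRo k).measurableSet) hdisj).trans
      (measure_mono (iUnion_subset hRJ))
  -- A geometric series bounds the sum of the powers of the radii.
  have hgeo : ∀ (a c : ℝ), 0 < a → 0 ≤ c → ∑' k, ENNReal.ofReal (c * r k ^ a) ≤
      ENNReal.ofReal (c * (δ' ^ a * (1 - (1 / 2) ^ a)⁻¹)) := by
    intro a c ha hc
    have hy0 : (0 : ℝ) ≤ (1 / 2) ^ a := by positivity
    have hy1 : ((1 : ℝ) / 2) ^ a < 1 := Real.rpow_lt_one (by norm_num) (by norm_num) ha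
    have e : ∀ k, c * r k ^ a = c * δ' ^ a * ((1 / 2) ^ a) ^ k := by
      intro k
      simp only [hr]
      rw [Real.mul_rpow hδ'0.le (by positivity), ← Real.rpow_natCast, ← Real.rpow_natCast,
        ← Real.rpow_mul (by norm_num), ← Real.rpow_mul (by norm_num), mul_comm a, mul_assoc]
    simp_rw [e]
    rw [← ENNReal.ofReal_tsum_of_nonneg (fun k ↦ by positivity)
      ((summable_geometric_of_lt_one hy0 hy1).mul_left _), tsum_mul_left,
      tsum_geometric_of_lt_one hy0 hy1, mul_assoc]
  calc ∫⁻ x in J, depthWeight C S (1 / (2 * K ^ 2)) θ δ' δ x * u (f x)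
      ≤ ∫⁻ x in ⋃ k, R k, depthWeight C S (1 / (2 * K ^ 2)) θ δ' δ x * u (f x) :=
        lintegral_mono_set hcover
    _ ≤ ∑' k, ∫⁻ x in R k, depthWeight C S (1 / (2 * K ^ 2)) θ δ' δ x * u (f x) :=
        lintegral_iUnion_le _ _
    _ ≤ ∑' k, (ENNReal.ofReal (A * volume.real (R k)) +
          ENNReal.ofReal (4 * (2 * δ) ^ (θ / 2) * A * r k ^ (θ / 2)) +
          ENNReal.ofReal (2 * K * B * r k ^ θ)) := by
        refine ENNReal.tsum_le_tsum fun k ↦ ?_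
        have hk := hr0 k
        rw [← ENNReal.ofReal_add (by positivity) (by positivity),
          ← ENNReal.ofReal_add (by positivity) (by positivity)]
        refine hS.lintegral_ring_le h hs (hr0 k) (hr1 k) hδ hδ' (hRo k) ((hRJ k).trans hJC)
          ((hRJ k).trans hJs) (fun x hx ↦ ⟨?_, hx.2.2⟩) hA hB (hu _ (hRJ k) (hRo k))
        refine lt_of_eq_of_lt ?_ hx.2.1
        simp only [hr]
        ring
    _ ≤ ENNReal.ofReal (A * volume.real J) +
          ENNReal.ofReal (4 * (2 * δ) ^ (θ / 2) * A *
            (δ' ^ (θ / 2) * (1 - (1 / 2) ^ (θ / 2))⁻¹)) +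
          ENNReal.ofReal (2 * K * B * (δ' ^ θ * (1 - (1 / 2) ^ θ)⁻¹)) := by
        rw [ENNReal.tsum_add, ENNReal.tsum_add]
        gcongr
        · exact hgeo _ _ (by positivity) (by positivity)
        · exact hgeo _ _ hθ (by positivity)
    _ ≤ _ := by
        have hg : ∀ a : ℝ, 0 < a → 0 < (1 - ((1 : ℝ) / 2) ^ a)⁻¹ := fun a ha ↦
          inv_pos.2 (sub_pos.2 (Real.rpow_lt_one (by norm_num) (by norm_num) ha))
        have hg1 := hg θ hθ
        have hg2 := hg (θ / 2) (by positivity)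
        rw [← ENNReal.ofReal_add (by positivity) (by positivity),
          ← ENNReal.ofReal_add (by positivity) (by positivity)]
        refine ENNReal.ofReal_le_ofReal ?_
        have h1 : 2 * K * B * (δ' ^ θ * (1 - (1 / 2) ^ θ)⁻¹) ≤ ρ * B := by
          calc _ = 2 * K * (δ' ^ θ * (1 - (1 / 2) ^ θ)⁻¹) * B := by ring
            _ ≤ _ := by gcongr
        have h2 : 4 * (2 * δ) ^ (θ / 2) * A * (δ' ^ (θ / 2) * (1 - (1 / 2) ^ (θ / 2))⁻¹) ≤
            τ * A := by
          calc _ = 4 * (2 * δ) ^ (θ / 2) * (1 - (1 / 2) ^ (θ / 2))⁻¹ * δ' ^ (θ / 2) * A := by ring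
            _ ≤ 4 * (2 * δ) ^ (θ / 2) * (1 - (1 / 2) ^ (θ / 2))⁻¹ * 1 * A := by
              gcongr
              exact Real.rpow_le_one hδ'0.le (hδ'.trans hS.le_one) (by positivity)
            _ ≤ _ := by rw [mul_one]; gcongr
        linarith

end

noncomputable section

/-! ### Growth of the exponential moments -/

variable {f : ℝ → ℝ} {C : Finset ℝ} {σ : ℝ} {J : Set ℝ} {S : Set OneSidedPoint}
  {K θ δ₀ : ℝ}

theorem depthWeight_eq_one {κ δ' δ x : ℝ} (hx : x ∉ zone S δ') :
    depthWeight C S κ θ δ' δ x = 1 := if_neg hx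

/-- Away from the singular zone, on an interval where the derivative oscillates by a factor at
most `r`. -/
theorem IsExpandingOff.lintegral_le_of_disjoint_zone (h : IsExpandingOff f C σ) {κ δ' δ r : ℝ}
    (hr : 1 ≤ r) (hJ : J.OrdConnected) (hJC : J ⊆ I \ C) (hJZ : Disjoint J (zone S δ'))
    (hosc : ∀ x ∈ J, ∀ y ∈ J, |der f x| ≤ r * |der f y|) {u : ℝ → ENNReal} {A B : ℝ}
    (hA : 0 ≤ A) (hB : 0 ≤ B)
    (hu : ∫⁻ x in f '' J, u x ≤ ENNReal.ofReal (A * volume.real (f '' J) + B)) :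
    ∫⁻ x in J, depthWeight C S κ θ δ' δ x * u (f x) ≤
      ENNReal.ofReal (r ^ 2 * A * volume.real J + σ⁻¹ * B) := by
  rcases J.eq_empty_or_nonempty with rfl | ⟨y, hy⟩
  · simp
  have hσ := h.one_lt
  have hr0 : 0 < r := by linarith
  have hy0 : σ ≤ |der f y| := h.le_abs_der y (hJC hy)
  have hm0 : 0 < max σ (|der f y| / r) := lt_of_lt_of_le (by linarith) (le_max_left _ _)
  refine (h.lintegral_mul_comp_le hJ hJC (m := max σ (|der f y| / r)) (M := r * |der f y|)
    (v := 1) hm0 zero_le_one hA (fun x hx ↦ ⟨max_le (h.le_abs_der x (hJC hx)) ?_, hosc x hx y hy⟩)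
    (fun x hx ↦ ?_) hu).trans (ENNReal.ofReal_le_ofReal ?_)
  · rw [div_le_iff₀' hr0]; exact hosc y hy x hx
  · rw [depthWeight_eq_one (Set.disjoint_left.1 hJZ hx)]; simp
  · have h3 : 0 < |der f y| := by linarith
    have h1 : 1 / max σ (|der f y| / r) ≤ σ⁻¹ := by
      rw [one_div]; exact inv_anti₀ (zero_lt_one.trans hσ) (le_max_left _ _)
    have h2 : 1 / max σ (|der f y| / r) ≤ r / |der f y| := by
      rw [div_le_iff₀ hm0]
      calc 1 = r / |der f y| * (|der f y| / r) := by field_simp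
        _ ≤ _ := by gcongr; exact le_max_right _ _
    have h0 : 0 ≤ volume.real J := measureReal_nonneg
    have h4 : 1 / max σ (|der f y| / r) * (A * (r * |der f y|) * volume.real J) ≤
        r ^ 2 * A * volume.real J := by
      calc 1 / max σ (|der f y| / r) * (A * (r * |der f y|) * volume.real J)
          ≤ r / |der f y| * (A * (r * |der f y|) * volume.real J) := by gcongr
        _ = _ := by field_simp
    rw [mul_add]
    gcongr

/-- The finite set `F` cuts `I` into intervals each of which either lies in the zone of one
singular point, or misses the zones and has distortion at most `r`. -/
structure IsAdapted (f : ℝ → ℝ) (C : Finset ℝ) (S : Set OneSidedPoint) (δ' r : ℝ)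
    (F : Finset ℝ) : Prop where
  subset : C ⊆ F
  cases : ∀ J : Set ℝ, J.OrdConnected → J ⊆ I \ F →
    (∃ s ∈ S, J ⊆ s.nbhd δ') ∨
      (Disjoint J (zone S δ') ∧ ∀ x ∈ J, ∀ y ∈ J, |der f x| ≤ r * |der f y|)

/-- `w` has integral at most `A |J| + B` over every interval `J ⊆ I` whose first `k` iterates
avoid `F`. -/
def GrowthBound (g : ℝ → ℝ) (F : Finset ℝ) (w : ℝ → ENNReal) (k : ℕ) (A B : ℝ) : Prop :=
  ∀ J : Set ℝ, J.OrdConnected → J ⊆ I → (∀ i < k, ∀ x ∈ J, g^[i] x ∉ F) →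
    ∫⁻ x in J, w x ≤ ENNReal.ofReal (A * volume.real J + B)

theorem GrowthBound.mono {g : ℝ → ℝ} {F : Finset ℝ} {w : ℝ → ENNReal} {k : ℕ} {A B A' B' : ℝ}
    (h : GrowthBound g F w k A B) (hA : A ≤ A') (hB : B ≤ B') : GrowthBound g F w k A' B' :=
  fun J hJ hJI hk ↦ (h J hJ hJI hk).trans (ENNReal.ofReal_le_ofReal (by
    have : 0 ≤ volume.real J := measureReal_nonneg
    gcongr))

/-- The weighted orbit product `∏_{j < n} ψ (g^j x)`. -/
def orbitProd (g : ℝ → ℝ) (ψ : ℝ → ENNReal) (n : ℕ) (x : ℝ) : ENNReal :=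
  ∏ j ∈ Finset.range n, ψ (g^[j] x)

theorem orbitProd_succ (g : ℝ → ℝ) (ψ : ℝ → ENNReal) (n : ℕ) (x : ℝ) :
    orbitProd g ψ (n + 1) x = ψ x * orbitProd g ψ n (g x) := by
  simp [orbitProd, Finset.prod_range_succ', Function.iterate_succ_apply, mul_comm]

theorem measurable_orbitProd {g : ℝ → ℝ} (hg : Measurable g) {ψ : ℝ → ENNReal}
    (hψ : Measurable ψ) (n : ℕ) : Measurable (orbitProd g ψ n) := by
  unfold orbitProd
  exact Finset.measurable_prod _ fun j _ ↦ hψ.comp (hg.iterate j)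

/-- The one-step growth estimate. -/
theorem GrowthBound.step (h : IsExpandingOff f C σ) (hS : IsUniformlySingular f C S K θ δ₀)
    {F : Finset ℝ} {δ' δ r τ : ℝ} (hr : 1 ≤ r) (hF : IsAdapted f C S δ' r F)
    (hδ : 0 < δ) (hδ'0 : 0 < δ') (hδ' : δ' ≤ δ₀)
    (hρ : 2 * K * (δ' ^ θ * (1 - (1 / 2) ^ θ)⁻¹) ≤ σ⁻¹)
    (hτ : 4 * (2 * δ) ^ (θ / 2) * (1 - (1 / 2) ^ (θ / 2))⁻¹ ≤ τ) (hτ0 : 0 ≤ τ)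
    {n k : ℕ} {A B : ℝ} (hA : 0 ≤ A) (hB : 0 ≤ B)
    (hw : GrowthBound (branchMap f C) F
      (orbitProd (branchMap f C) (depthWeight C S (1 / (2 * K ^ 2)) θ δ' δ) n) k A B) :
    GrowthBound (branchMap f C) F
      (orbitProd (branchMap f C) (depthWeight C S (1 / (2 * K ^ 2)) θ δ' δ) (n + 1)) (k + 1)
      (r ^ 2 * A) (σ⁻¹ * B + τ * A) := by
  intro J hJ hJI hk
  have hσ := h.one_lt
  have hJF : J ⊆ I \ F := fun x hx ↦ ⟨hJI hx, hk 0 (Nat.succ_pos k) x hx⟩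
  have hJC : J ⊆ I \ C := fun x hx ↦ ⟨hJI hx, fun hxC ↦ (hJF hx).2 (hF.subset hxC)⟩
  have heq : ∫⁻ x in J, orbitProd (branchMap f C)
        (depthWeight C S (1 / (2 * K ^ 2)) θ δ' δ) (n + 1) x =
      ∫⁻ x in J, depthWeight C S (1 / (2 * K ^ 2)) θ δ' δ x * orbitProd (branchMap f C)
        (depthWeight C S (1 / (2 * K ^ 2)) θ δ' δ) n (f x) :=
    setLIntegral_congr_fun hJ.measurableSet fun x hx ↦ by
      simp only [orbitProd_succ, branchMap_of_mem (hJC hx)]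
  rw [heq]
  have hu : ∀ J' ⊆ J, J'.OrdConnected → ∫⁻ x in f '' J', orbitProd (branchMap f C)
      (depthWeight C S (1 / (2 * K ^ 2)) θ δ' δ) n x ≤
      ENNReal.ofReal (A * volume.real (f '' J') + B) := by
    intro J' hJ' ho
    refine hw _ (h.ordConnected_image ho (hJ'.trans hJC)) (h.image_subset (hJ'.trans hJC)) ?_
    rintro i hi _ ⟨x, hx, rfl⟩
    have := hk (i + 1) (by omega) x (hJ' hx)
    rwa [Function.iterate_succ_apply, branchMap_of_mem (hJC (hJ' hx))] at this
  have hv : 0 ≤ volume.real J := measureReal_nonneg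
  rcases hF.cases J hJ hJF with ⟨s, hs, hJs⟩ | ⟨hdisj, hosc⟩
  · refine (hS.lintegral_nbhd_le h hs hδ hδ'0 hδ' hρ hτ hJ hJC hJs hA hB hu).trans
      (ENNReal.ofReal_le_ofReal ?_)
    gcongr
    nlinarith [mul_nonneg hA (sub_nonneg.2 hr)]
  · refine (h.lintegral_le_of_disjoint_zone hr hJ hJC hdisj hosc hA hB (hu J subset_rfl hJ)).trans
      (ENNReal.ofReal_le_ofReal ?_)
    have : 0 ≤ τ * A := by positivity
    linarith

/-- The exponential moments of the recurrence depth grow at an arbitrarily small rate, provided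
the depth is only counted very close to the singular points. -/
theorem exists_lintegral_orbitProd_le (h : IsExpandingOff f C σ)
    (hS : IsUniformlySingular f C S K θ δ₀) {F : Finset ℝ} {δ' r : ℝ} (hr : 1 < r)
    (hF : IsAdapted f C S δ' r F) (hδ'0 : 0 < δ') (hδ' : δ' ≤ δ₀)
    (hρ : 2 * K * (δ' ^ θ * (1 - (1 / 2) ^ θ)⁻¹) ≤ σ⁻¹) :
    ∃ N : ℕ, 1 ≤ N ∧ ∃ A : ℝ, 0 ≤ A ∧ ∃ δ > 0, δ ≤ δ' ∧ ∀ m : ℕ,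
      ∫⁻ x in I, orbitProd (branchMap f C) (depthWeight C S (1 / (2 * K ^ 2)) θ δ' δ)
        (m * N) x ≤ ENNReal.ofReal ((r ^ 4) ^ (m * N) * (A + 1)) := by
  have hσ := h.one_lt
  have hσ0 : 0 < σ⁻¹ := by positivity
  have hσ1 : σ⁻¹ < 1 := inv_lt_one_of_one_lt₀ hσ
  obtain ⟨ρ, hρ1, hρ2⟩ := exists_between hσ1
  have hρ0 : 0 < ρ := hσ0.trans hρ1
  -- Over `N` steps the contraction beats the doubling caused by a cut.
  obtain ⟨N, hN1, hN⟩ : ∃ N : ℕ, 1 ≤ N ∧ 2 * ρ ^ N ≤ 1 := by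
    have := (tendsto_pow_atTop_nhds_zero_of_lt_one hρ0.le hρ2).eventually
      (ge_mem_nhds (show (0 : ℝ) < 1 / 2 by norm_num))
    obtain ⟨N, h1, h2⟩ := (this.and (eventually_ge_atTop 1)).exists
    exact ⟨N, h2, by linarith⟩
  have hFN : {x ∈ I | ∃ i < N, (branchMap f C)^[i] x ∈ F}.Finite := by
    have : {x ∈ I | ∃ i < N, (branchMap f C)^[i] x ∈ F} =
        ⋃ i ∈ Iio N, {x ∈ I | (branchMap f C)^[i] x ∈ (F : Set ℝ)} := by
      ext x
      simp only [mem_ofPred_eq, mem_iUnion, mem_Iio, Finset.mem_coe, exists_prop]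
      tauto
    rw [this]
    exact (finite_Iio N).biUnion fun i _ ↦ h.finite_iterate_preimage F.finite_toSet i
  obtain ⟨R, hR0, hR⟩ := exists_lintegral_le_of_avoiding hFN.toFinset
  set E := r ^ 2 with hE
  have hE1 : 1 < E := one_lt_pow₀ hr two_ne_zero
  have hEN : 1 < E ^ N := one_lt_pow₀ hE1 (by omega)
  have hED : 0 < E ^ (2 * N) - E ^ N := by
    rw [two_mul, pow_add]; nlinarith
  set A := R / (E ^ (2 * N) - E ^ N) with hA
  have hA0 : 0 ≤ A := by positivity
  have hAR : E ^ N * A + R = E ^ (2 * N) * A := by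
    rw [hA]; field_simp; ring
  set τ := (ρ - σ⁻¹) * ρ ^ N / (E ^ N * A + 1) with hτ
  have hτ0 : 0 < τ := by
    have : 0 < ρ - σ⁻¹ := by linarith
    positivity
  have hτA : τ * (E ^ N * A) ≤ (ρ - σ⁻¹) * ρ ^ N := by
    calc τ * (E ^ N * A) ≤ τ * (E ^ N * A + 1) := by gcongr; linarith
      _ = _ := by rw [hτ]; field_simp
  obtain ⟨δ, hδ0, hδδ', hδτ⟩ : ∃ δ > 0, δ ≤ δ' ∧
      4 * (2 * δ) ^ (θ / 2) * (1 - (1 / 2) ^ (θ / 2))⁻¹ ≤ τ := by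
    have hθ := hS.theta_pos
    have hcont : Continuous fun δ : ℝ ↦ 4 * (2 * δ) ^ (θ / 2) * (1 - (1 / 2) ^ (θ / 2))⁻¹ := by
      have : Continuous fun δ : ℝ ↦ (2 * δ) ^ (θ / 2) :=
        (continuous_const.mul continuous_id).rpow_const fun _ ↦ Or.inr (by positivity)
      fun_prop
    have hlim := hcont.tendsto 0
    simp only [mul_zero, Real.zero_rpow (show θ / 2 ≠ 0 by positivity), zero_mul] at hlim
    have h1 := (hlim.mono_left (nhdsWithin_le_nhds (s := Ioi 0))).eventually (ge_mem_nhds hτ0)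
    obtain ⟨δ, h2, h3⟩ := (h1.and (Ioo_mem_nhdsGT hδ'0)).exists
    exact ⟨δ, h3.1, h3.2.le, h2⟩
  refine ⟨N, hN1, A, hA0, δ, hδ0, hδδ', ?_⟩
  set ψ := depthWeight C S (1 / (2 * K ^ 2)) θ δ' δ with hψ
  set g := branchMap f C with hg
  have hsteps : ∀ (n : ℕ) (G : ℝ), 0 ≤ G → GrowthBound g F (orbitProd g ψ n) 0 (G * A) G →
      ∀ k ≤ N, GrowthBound g F (orbitProd g ψ (n + k)) k (E ^ k * (G * A)) (ρ ^ k * G) := by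
    intro n G hG hn k
    induction k with
    | zero => intro _; simpa using hn
    | succ k ih =>
      intro hk
      have hstep := GrowthBound.step h hS hr.le hF hδ0 hδ'0 hδ' hρ hδτ hτ0.le
        (by positivity) (by positivity) (ih (by omega))
      refine hstep.mono (le_of_eq (by rw [pow_succ, hE]; ring)) ?_
      have h1 : τ * (E ^ k * A) ≤ (ρ - σ⁻¹) * ρ ^ k := by
        calc τ * (E ^ k * A) ≤ τ * (E ^ N * A) := by
              gcongr
              · exact hE1.le
              · omega
          _ ≤ (ρ - σ⁻¹) * ρ ^ N := hτA
          _ ≤ _ := mul_le_mul_of_nonneg_left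
              (pow_le_pow_of_le_one hρ0.le hρ2.le (by omega)) (by linarith)
      calc σ⁻¹ * (ρ ^ k * G) + τ * (E ^ k * (G * A))
          = (σ⁻¹ * ρ ^ k + τ * (E ^ k * A)) * G := by ring
        _ ≤ (σ⁻¹ * ρ ^ k + (ρ - σ⁻¹) * ρ ^ k) * G := by gcongr
        _ = _ := by ring
  have hgrow : ∀ m : ℕ, GrowthBound g F (orbitProd g ψ (m * N)) 0
      ((E ^ (2 * N)) ^ m * A) ((E ^ (2 * N)) ^ m) := by
    intro m
    induction m with
    | zero =>
      intro J hJ hJI _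
      simp only [zero_mul, orbitProd, Finset.range_zero, Finset.prod_empty, lintegral_const,
        one_mul, pow_zero, Measure.restrict_apply, MeasurableSet.univ, univ_inter]
      have h1 : volume J ≤ 1 := (measure_mono hJI).trans (by simp)
      have h0 : 0 ≤ volume.real J := measureReal_nonneg
      calc volume J ≤ ENNReal.ofReal 1 := by simpa using h1
        _ ≤ _ := ENNReal.ofReal_le_ofReal (by nlinarith)
    | succ m ih =>
      intro J hJ hJI _
      set G := (E ^ (2 * N)) ^ m with hG
      have hG0 : 0 ≤ G := by positivity
      have h1 := hsteps _ G hG0 ih N le_rfl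
      rw [Nat.succ_mul]
      refine (hR _ (E ^ N * (G * A)) (ρ ^ N * G) (by positivity) (by positivity)
        (fun J' hJ' hJF ↦ h1 J' hJ' (hJF.trans sdiff_subset) fun i hi x hx hxF ↦ ?_)
        J hJ hJI).trans (ENNReal.ofReal_le_ofReal ?_)
      · exact (hJF hx).2 (hFN.mem_toFinset.2 ⟨(hJF hx).1, i, hi, hxF⟩)
      · have h0 : 0 ≤ volume.real J := measureReal_nonneg
        have hE2 : 1 ≤ E ^ (2 * N) := one_le_pow₀ hE1.le
        rw [pow_succ, ← hG]
        have hcut : E ^ N * (G * A) + R * (ρ ^ N * G) ≤ G * E ^ (2 * N) * A := by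
          calc E ^ N * (G * A) + R * (ρ ^ N * G) ≤ E ^ N * (G * A) + R * (1 * G) := by
                gcongr; exact pow_le_one₀ hρ0.le hρ2.le
            _ = G * (E ^ N * A + R) := by ring
            _ = _ := by rw [hAR]; ring
        have htwo : 2 * (ρ ^ N * G) ≤ G * E ^ (2 * N) := by nlinarith
        gcongr
  intro m
  refine (hgrow m I ordConnected_Icc subset_rfl (by simp)).trans (le_of_eq ?_)
  have e : (r ^ 4) ^ (m * N) = (E ^ (2 * N)) ^ m := by
    rw [hE]
    simp only [← pow_mul]
    congr 1
    ring
  rw [show volume.real I = 1 by simp [measureReal_def], e]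
  congr 1
  ring

/-- With a large weight `Q` on the zone that is still dominated by `|f'|`, the orbit products have
integrals growing no faster than the number of branches. Hence orbits rarely visit the zone. -/
theorem IsExpandingOff.lintegral_orbitProd_le (h : IsExpandingOff f C σ) {ψ : ℝ → ENNReal}
    (hψ : ∀ x ∈ I \ (C : Set ℝ), ψ x ≤ ENNReal.ofReal |der f x|) (n : ℕ) :
    ∫⁻ x in I, orbitProd (branchMap f C) ψ n x ≤ ENNReal.ofReal ((2 ^ C.card) ^ n) := by
  induction n with
  | zero => simp [orbitProd]
  | succ n ih =>
    refine (lintegral_le_of_avoiding C le_rfl (B := (2 ^ C.card) ^ n) (by positivity) I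
      ordConnected_Icc subset_rfl fun J hJI hJ hJC ↦ ?_).trans
      (ENNReal.ofReal_le_ofReal (by rw [pow_succ]; linarith))
    calc ∫⁻ x in J, orbitProd (branchMap f C) ψ (n + 1) x
        ≤ ∫⁻ x in J, ENNReal.ofReal |der f x| * orbitProd (branchMap f C) ψ n (f x) := by
          refine setLIntegral_mono' hJ.measurableSet fun x hx ↦ ?_
          rw [orbitProd_succ, branchMap_of_mem (hJC hx)]
          gcongr
          exact hψ x (hJC hx)
      _ = ∫⁻ x in f '' J, orbitProd (branchMap f C) ψ n x := (h.lintegral_image hJ hJC _).symm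
      _ ≤ ∫⁻ x in I, orbitProd (branchMap f C) ψ n x := lintegral_mono_set (h.image_subset hJC)
      _ ≤ _ := by simpa using ih

end

noncomputable section

/-! ### Uniform constants for a piecewise smooth map -/

variable {f : ℝ → ℝ} {C : Finset ℝ} {σ α : ℝ} {J : Set ℝ}

theorem finite_oneSidedPoints (C : Finset ℝ) : (oneSidedPoints C).Finite := by
  refine ((C.finite_toSet.image fun x ↦ OneSidedPoint.mk x Side.left).union
    (C.finite_toSet.image fun x ↦ OneSidedPoint.mk x Side.right)).subset ?_
  rintro ⟨p, _ | _⟩ ⟨hp, -⟩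
  · exact Or.inl ⟨p, hp, rfl⟩
  · exact Or.inr ⟨p, hp, rfl⟩

theorem exists_isExpandingOff (hf : IsPiecewiseC1Alpha f C α) (hexp : IsUniformlyExpanding f C) :
    ∃ σ, IsExpandingOff f C σ := by
  obtain ⟨σ, hσ, h⟩ := hexp
  exact ⟨σ, hf.mapsTo, hf.differentiable, hσ, h⟩

theorem exists_infDist_eq (C : Finset ℝ) : ∃ r > 0, ∀ c ∈ C, ∀ t : ℝ, |t - c| < r →
    Metric.infDist t (C : Set ℝ) = |t - c| := by
  obtain ⟨r, hr0, hr⟩ := exists_gap C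
  refine ⟨r / 2, by positivity, fun c hc t ht ↦ le_antisymm ?_ ?_⟩
  · exact Metric.infDist_le_dist_of_mem (Finset.mem_coe.2 hc)
  · refine (Metric.le_infDist ⟨c, hc⟩).2 fun y hy ↦ ?_
    rw [Real.dist_eq]
    have hsep : y ≠ c → r < |y - c| := fun hne ↦ by
      rcases lt_or_gt_of_ne hne with h | h
      · rw [abs_sub_comm]; exact (hr y hy c hc h).trans_le (le_abs_self _)
      · exact (hr c hc y hy h).trans_le (le_abs_self _)
    by_cases hyc : y = c
    · rw [hyc]
    · have h1 := hsep hyc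
      have h2 : |y - c| ≤ |t - y| + |t - c| := by
        rw [abs_sub_comm t y]
        exact abs_sub_le y t c
      linarith

/-- The finitely many singular points have common constants. -/
theorem exists_isUniformlySingular (f : ℝ → ℝ) (C : Finset ℝ) : ∃ K θ δ₀ : ℝ, 0 < δ₀ ∧
    IsUniformlySingular f C (singularPoints f C) K θ δ₀ := by
  have hfin : (singularPoints f C).Finite :=
    (finite_oneSidedPoints C).subset fun c hc ↦ hc.1
  have hdata : ∀ s ∈ singularPoints f C, ∃ β : ℝ, 0 < β ∧ β < 1 ∧ ∃ δ > 0, ∃ K ≥ 1,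
      ∀ t ∈ s.nbhd δ, K⁻¹ * |t - s.pos| ^ (β - 1) ≤ |der f t| ∧
        |der f t| ≤ K * |t - s.pos| ^ (β - 1) := by
    rintro s ⟨-, β, hβ0, hβ1, L, -, δ, hδ, K, hK, h⟩
    exact ⟨β, hβ0, hβ1, δ, hδ, K, hK, fun t ht ↦ (h t ht).2⟩
  choose! β hβ0 hβ1 δ hδ K hK h using hdata
  obtain ⟨r, hr0, hr⟩ := exists_infDist_eq C
  have hKev : ∀ᶠ k in atTop, ∀ s ∈ singularPoints f C, K s ≤ k :=
    (hfin.eventually_all).2 fun s _ ↦ eventually_ge_atTop (K s)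
  have hθev : ∀ᶠ θ in 𝓝[>] (0 : ℝ), ∀ s ∈ singularPoints f C, 2 * θ ≤ 1 - β s :=
    (hfin.eventually_all).2 fun s hs ↦ by
      filter_upwards [Ioo_mem_nhdsGT (show 0 < (1 - β s) / 2 by linarith [hβ1 s hs])] with θ hθ
      linarith [hθ.2]
  have hδev : ∀ᶠ d in 𝓝[>] (0 : ℝ), ∀ s ∈ singularPoints f C, d ≤ δ s :=
    (hfin.eventually_all).2 fun s hs ↦ by
      filter_upwards [Ioo_mem_nhdsGT (hδ s hs)] with d hd using hd.2.le
  obtain ⟨k, hk, hk1⟩ := (hKev.and (eventually_ge_atTop 1)).exists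
  obtain ⟨θ, hθ, hθ0⟩ := (hθev.and self_mem_nhdsWithin).exists
  obtain ⟨d, hd, hd0⟩ := (hδev.and (Ioo_mem_nhdsGT (lt_min zero_lt_one hr0))).exists
  have hk0 : 0 < k := by linarith
  refine ⟨k, θ, d, hd0.1, hk1, hθ0, hd0.2.le.trans (min_le_left _ _), fun s hs ↦ ?_,
    fun s hs t ht ↦ ?_⟩
  · refine ⟨β s, hβ0 s hs, hθ s hs, fun t ht ↦ ?_⟩
    obtain ⟨h1, h2⟩ := h s hs t (OneSidedPoint.nbhd_mono (hd s hs) ht)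
    have hKs : 0 < K s := by linarith [hK s hs]
    have hp : 0 ≤ |t - s.pos| ^ (β s - 1) := by positivity
    exact ⟨le_trans (mul_le_mul_of_nonneg_right (inv_anti₀ hKs (hk s hs)) hp) h1,
      h2.trans (mul_le_mul_of_nonneg_right (hk s hs) hp)⟩
  · exact hr s.pos hs.1.1 t ((OneSidedPoint.abs_sub_of_mem_nbhd ht).2.trans
      (hd0.2.trans_le (min_le_right _ _)))

theorem subset_Ioo_of_ordConnected (hJ : J.OrdConnected) {x a b : ℝ} (hx : x ∈ J)
    (hxab : x ∈ Ioo a b) (ha : a ∉ J) (hb : b ∉ J) : J ⊆ Ioo a b := by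
  refine fun y hy ↦ ⟨?_, ?_⟩
  · by_contra! hya
    exact ha (hJ.out hy hx ⟨hya, hxab.1.le⟩)
  · by_contra! hyb
    exact hb (hJ.out hx hy ⟨hxab.2.le, hyb⟩)

/-- A Hölder bound for the derivative controls its ratios on short intervals. -/
theorem exists_abs_der_le_mul (hα : 0 < α) (hσ : 0 < σ) {r : ℝ} (hr : 1 < r) (H : ℝ) :
    ∃ ρ > 0, ∀ x y : ℝ, |x - y| < ρ → |der f x - der f y| ≤ H * |x - y| ^ α →
      σ ≤ |der f y| → |der f x| ≤ r * |der f y| := by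
  have hcont : Continuous fun d : ℝ ↦ |H| * d ^ α :=
    continuous_const.mul (continuous_id.rpow_const fun _ ↦ Or.inr hα.le)
  have hlim := hcont.tendsto 0
  simp only [Real.zero_rpow hα.ne', mul_zero] at hlim
  have h1 := (hlim.mono_left (nhdsWithin_le_nhds (s := Ioi 0))).eventually
    (ge_mem_nhds (show 0 < (r - 1) * σ by nlinarith))
  obtain ⟨ρ, hρ, hρ0⟩ := (h1.and self_mem_nhdsWithin).exists
  refine ⟨ρ, hρ0, fun x y hxy hH hy ↦ ?_⟩
  have h2 : H * |x - y| ^ α ≤ |H| * ρ ^ α := by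
    gcongr
    exact le_abs_self H
  have h3 : |der f x| ≤ |der f y| + |der f x - der f y| := by
    have := abs_sub_abs_le_abs_sub (der f x) (der f y)
    linarith
  nlinarith

/-- One-sided control of the oscillation of `f'` outside the singular zone. -/
theorem exists_abs_der_le_mul_on_nbhd (hα : 0 < α) (hf : IsPiecewiseC1Alpha f C α)
    (h : IsExpandingOff f C σ) (hreg : IsHolderNearRegularPoints f C α) {δ' r : ℝ}
    (hδ' : 0 < δ') (hr : 1 < r) {z : ℝ} (hz : z ∈ I) (d : Side) :
    ∃ ρ > 0, ∀ x ∈ (OneSidedPoint.mk z d).nbhd ρ, ∀ y ∈ (OneSidedPoint.mk z d).nbhd ρ,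
      x ∈ I \ (C : Set ℝ) → y ∈ I \ (C : Set ℝ) → x ∉ zone (singularPoints f C) δ' →
      |der f x| ≤ r * |der f y| := by
  have hσ : 0 < σ := by linarith [h.one_lt]
  have hclose : ∀ ρ : ℝ, ∀ x ∈ (OneSidedPoint.mk z d).nbhd ρ,
      ∀ y ∈ (OneSidedPoint.mk z d).nbhd ρ, |x - y| < ρ := by
    intro ρ x hx y hy
    cases d
    · obtain ⟨hx1, hx2⟩ : z - ρ < x ∧ x < z := hx
      obtain ⟨hy1, hy2⟩ : z - ρ < y ∧ y < z := hy
      rw [abs_lt]; constructor <;> linarith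
    · obtain ⟨hx1, hx2⟩ : z < x ∧ x < z + ρ := hx
      obtain ⟨hy1, hy2⟩ : z < y ∧ y < z + ρ := hy
      rw [abs_lt]; constructor <;> linarith
  by_cases hzC : z ∈ C
  · by_cases hzS : OneSidedPoint.mk z d ∈ singularPoints f C
    · exact ⟨δ', hδ', fun x hx _ _ _ _ hxz ↦ (hxz (mem_biUnion hzS hx)).elim⟩
    · by_cases hzI : (OneSidedPoint.mk z d).InInterval
      · obtain ⟨H, hH⟩ := hreg
        obtain ⟨δ, hδ, hHδ⟩ := hH _ ⟨⟨hzC, hzI⟩, hzS⟩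
        obtain ⟨ρ, hρ, hρr⟩ := exists_abs_der_le_mul (f := f) hα hσ hr H
        refine ⟨min ρ δ, lt_min hρ hδ, fun x hx y hy _ hyC _ ↦ hρr x y
          ((hclose _ x hx y hy).trans_le (min_le_left _ _)) ?_ (h.le_abs_der y hyC)⟩
        exact hHδ y (OneSidedPoint.nbhd_mono (min_le_right _ _) hy) x
          (OneSidedPoint.nbhd_mono (min_le_right _ _) hx)
      · refine ⟨1, one_pos, fun x hx _ _ hxI _ _ ↦ (hzI ?_).elim⟩
        cases d
        · exact ⟨hxI.1.1.trans_lt hx.2, hz.2⟩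
        · exact ⟨hz.1, lt_of_lt_of_le hx.1 hxI.1.2⟩
  · obtain ⟨δ, hδ, H, hH⟩ := hf.locallyHolder z ⟨hz, hzC⟩
    obtain ⟨ρ, hρ, hρr⟩ := exists_abs_der_le_mul (f := f) hα hσ hr H
    have hsub : (OneSidedPoint.mk z d).nbhd (min ρ δ) ⊆ Ioo (z - δ) (z + δ) := fun x hx ↦ by
      have := abs_lt.1 (((OneSidedPoint.abs_sub_of_mem_nbhd hx).2).trans_le (min_le_right ρ δ))
      simp only at this
      exact ⟨by linarith [this.1], by linarith [this.2]⟩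
    exact ⟨min ρ δ, lt_min hρ hδ, fun x hx y hy hxI hyC _ ↦ hρr x y
      ((hclose _ x hx y hy).trans_le (min_le_left _ _))
      (hH x ⟨hxI.1, hsub hx⟩ y ⟨hyC.1, hsub hy⟩) (h.le_abs_der y hyC)⟩

theorem exists_isAdapted (hα : 0 < α) (hf : IsPiecewiseC1Alpha f C α)
    (h : IsExpandingOff f C σ) (hreg : IsHolderNearRegularPoints f C α) {δ' r : ℝ}
    (hδ' : 0 < δ') (hr : 1 < r) : ∃ F : Finset ℝ, IsAdapted f C (singularPoints f C) δ' r F := by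
  classical
  have hloc : ∀ z ∈ I, ∃ ρ > 0, ∀ d : Side, ∀ x ∈ (OneSidedPoint.mk z d).nbhd ρ,
      ∀ y ∈ (OneSidedPoint.mk z d).nbhd ρ, x ∈ I \ (C : Set ℝ) → y ∈ I \ (C : Set ℝ) →
      x ∉ zone (singularPoints f C) δ' → |der f x| ≤ r * |der f y| := by
    intro z hz
    obtain ⟨ρ₁, hρ₁, h₁⟩ := exists_abs_der_le_mul_on_nbhd hα hf h hreg hδ' hr hz Side.left
    obtain ⟨ρ₂, hρ₂, h₂⟩ := exists_abs_der_le_mul_on_nbhd hα hf h hreg hδ' hr hz Side.right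
    refine ⟨min ρ₁ ρ₂, lt_min hρ₁ hρ₂, fun d x hx y hy ↦ ?_⟩
    cases d
    · exact h₁ x (OneSidedPoint.nbhd_mono (min_le_left _ _) hx) y
        (OneSidedPoint.nbhd_mono (min_le_left _ _) hy)
    · exact h₂ x (OneSidedPoint.nbhd_mono (min_le_right _ _) hx) y
        (OneSidedPoint.nbhd_mono (min_le_right _ _) hy)
  choose! ρ hρ0 hρ using hloc
  obtain ⟨t, htI, ht⟩ := isCompact_Icc.elim_nhds_subcover (s := I)
    (fun z ↦ Ioo (z - ρ z) (z + ρ z)) fun z hz ↦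
      Ioo_mem_nhds (by linarith [hρ0 z hz]) (by linarith [hρ0 z hz])
  refine ⟨C ∪ (t ∪ (t.image (fun z ↦ z - ρ z) ∪ (t.image (fun z ↦ z + ρ z) ∪
    (C.image (fun z ↦ z - δ') ∪ C.image (fun z ↦ z + δ'))))), Finset.subset_union_left,
    fun J hJ hJF ↦ ?_⟩
  have havoid : ∀ x ∈ J, x ∉ C ∧ (∀ z ∈ t, x ≠ z) ∧ (∀ z ∈ t, x ≠ z - ρ z) ∧
      (∀ z ∈ t, x ≠ z + ρ z) ∧ (∀ z ∈ C, x ≠ z - δ') ∧ ∀ z ∈ C, x ≠ z + δ' := by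
    intro x hx
    have hxF := (hJF hx).2
    simp only [Finset.coe_union, Finset.coe_image, mem_union, mem_image, Finset.mem_coe,
      not_or, not_exists, not_and] at hxF
    obtain ⟨h1, h2, h3, h4, h5, h6⟩ := hxF
    exact ⟨h1, fun z hz e ↦ h2 (e ▸ hz), fun z hz e ↦ h3 z hz e.symm, fun z hz e ↦ h4 z hz e.symm,
      fun z hz e ↦ h5 z hz e.symm, fun z hz e ↦ h6 z hz e.symm⟩
  have hJC : J ⊆ I \ C := fun x hx ↦ ⟨(hJF hx).1, (havoid x hx).1⟩
  by_cases hmeet : ∃ x ∈ J, x ∈ zone (singularPoints f C) δ'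
  · obtain ⟨x, hxJ, hxz⟩ := hmeet
    obtain ⟨s, hs, hxs⟩ := mem_iUnion₂.1 hxz
    refine Or.inl ⟨s, hs, ?_⟩
    have hsC : s.pos ∈ C := hs.1.1
    rcases s with ⟨p, _ | _⟩
    · exact subset_Ioo_of_ordConnected hJ hxJ hxs (fun hp ↦ (havoid _ hp).2.2.2.2.1 p hsC rfl)
        fun hp ↦ (havoid _ hp).1 hsC
    · exact subset_Ioo_of_ordConnected hJ hxJ hxs (fun hp ↦ (havoid _ hp).1 hsC)
        fun hp ↦ (havoid _ hp).2.2.2.2.2 p hsC rfl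
  · have hJz : ∀ x ∈ J, x ∉ zone (singularPoints f C) δ' := fun x hx hxz ↦ hmeet ⟨x, hx, hxz⟩
    refine Or.inr ⟨Set.disjoint_left.2 hJz, fun x hx y hy ↦ ?_⟩
    obtain ⟨z, hz, hxz⟩ := mem_iUnion₂.1 (ht (hJC hx).1)
    obtain ⟨d, hd⟩ : ∃ d : Side, J ⊆ (OneSidedPoint.mk z d).nbhd (ρ z) := by
      have hzJ : z ∉ J := fun hzJ ↦ (havoid z hzJ).2.1 z hz rfl
      rcases lt_or_gt_of_ne ((havoid x hx).2.1 z hz) with hlt | hgt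
      · exact ⟨Side.left, subset_Ioo_of_ordConnected hJ hx ⟨hxz.1, hlt⟩
          (fun hp ↦ (havoid _ hp).2.2.1 z hz rfl) hzJ⟩
      · exact ⟨Side.right, subset_Ioo_of_ordConnected hJ hx ⟨hgt, hxz.2⟩ hzJ
          fun hp ↦ (havoid _ hp).2.2.2.1 z hz rfl⟩
    exact hρ z (htI z hz) d x (hd hx) y (hd hy) (hJC hx) (hJC hy) (hJz x hx)

end

noncomputable section

/-! ### Transferring the depth at a regular point to a singular point -/

variable {f : ℝ → ℝ} {C : Finset ℝ} {α : ℝ} {S : Set OneSidedPoint} {K θ δ₀ : ℝ}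

theorem OneSidedPoint.eventually_approach {c : OneSidedPoint} {p : ℝ → Prop} :
    (∀ᶠ t in c.approach, p t) ↔ ∃ δ > 0, ∀ t ∈ c.nbhd δ, p t := by
  rcases c with ⟨x, _ | _⟩
  · show {t | p t} ∈ 𝓝[<] x ↔ _
    rw [mem_nhdsLT_iff_exists_Ioo_subset]
    constructor
    · rintro ⟨l, hl, hs⟩
      exact ⟨x - l, sub_pos.2 hl, fun t ht ↦ hs ⟨by have : x - (x - l) < t := ht.1; linarith,
        ht.2⟩⟩
    · rintro ⟨δ, hδ, h⟩
      exact ⟨x - δ, by simpa using hδ, h⟩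
  · show {t | p t} ∈ 𝓝[>] x ↔ _
    rw [mem_nhdsGT_iff_exists_Ioo_subset]
    constructor
    · rintro ⟨u, hu, hs⟩
      exact ⟨u - x, sub_pos.2 hu, fun t ht ↦ hs ⟨ht.1, by have : t < x + (u - x) := ht.2; linarith⟩⟩
    · rintro ⟨δ, hδ, h⟩
      exact ⟨x + δ, by simpa using hδ, h⟩

instance (c : OneSidedPoint) : c.approach.NeBot := by
  rcases c with ⟨x, _ | _⟩
  · exact inferInstanceAs (𝓝[<] x).NeBot
  · exact inferInstanceAs (𝓝[>] x).NeBot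

theorem OneSidedPoint.approach_le (c : OneSidedPoint) : c.approach ≤ 𝓝 c.pos := by
  rcases c with ⟨x, _ | _⟩ <;> exact nhdsWithin_le_nhds

/-- The restriction of a map tending to `c.pos` to the times when it lies on the side of `c`
tends to `c`. -/
theorem OneSidedPoint.tendsto_approach {c : OneSidedPoint} {l : Filter ℝ} {u : ℝ → ℝ} {δ : ℝ}
    (hu : Tendsto u l (𝓝 c.pos)) : Tendsto u (l ⊓ 𝓟 {t | u t ∈ c.nbhd δ}) c.approach := by
  have hp : Tendsto u (l ⊓ 𝓟 {t | u t ∈ c.nbhd δ}) (𝓝 c.pos) := hu.mono_left inf_le_left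
  have he : ∀ᶠ t in l ⊓ 𝓟 {t | u t ∈ c.nbhd δ}, u t ∈ c.nbhd δ :=
    mem_inf_of_right (mem_principal_self _)
  rcases c with ⟨x, _ | _⟩
  · exact tendsto_nhdsWithin_iff.2 ⟨hp, he.mono fun t ht ↦ ht.2⟩
  · exact tendsto_nhdsWithin_iff.2 ⟨hp, he.mono fun t ht ↦ ht.1⟩

/-- Critical orders make `f` Hölder at the points of `C`, from each side along which the orbit
arrives. -/
theorem exists_holder_on_side (hord : HasCriticalOrders f C) {l : Filter ℝ} {u : ℝ → ℝ}
    {y y' : ℝ} (hu : Tendsto u l (𝓝 y)) (huI : ∀ᶠ t in l, u t ∈ I \ (C : Set ℝ))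
    (hfu : Tendsto (fun t ↦ f (u t)) l (𝓝 y')) (hyI : y ∈ I) (hyC : y ∈ C) (d : Side) :
    ∃ β > (0 : ℝ), ∃ K ≥ (0 : ℝ), ∀ᶠ t in l, u t ∈ (OneSidedPoint.mk y d).nbhd 2 →
      |f (u t) - y'| ≤ K * |u t - y| ^ β := by
  by_cases hfr : ∃ᶠ t in l, u t ∈ (OneSidedPoint.mk y d).nbhd 2
  · obtain ⟨t, ht, htI⟩ := (hfr.and_eventually huI).exists
    have hD : OneSidedPoint.mk y d ∈ oneSidedPoints C := by
      refine ⟨hyC, ?_⟩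
      cases d
      · exact ⟨htI.1.1.trans_lt ht.2, hyI.2⟩
      · exact ⟨hyI.1, lt_of_lt_of_le ht.1 htI.1.2⟩
    obtain ⟨β, hβ, -, L, hL, δ, hδ, K, hK, h⟩ := hord _ hD
    have hne : (l ⊓ 𝓟 {t | u t ∈ (OneSidedPoint.mk y d).nbhd 2}).NeBot :=
      frequently_iff_neBot.1 hfr
    have hLy : L = y' := tendsto_nhds_unique
      (hL.comp (OneSidedPoint.tendsto_approach (c := ⟨y, d⟩) (δ := 2) hu))
      (hfu.mono_left inf_le_left)
    refine ⟨β, hβ, K, by linarith, ?_⟩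
    filter_upwards [hu.eventually (Metric.ball_mem_nhds y hδ)] with t ht ht2
    rw [Real.dist_eq] at ht
    rw [← hLy]
    exact (h _ (OneSidedPoint.mem_nbhd_of_abs_lt ht2 ht)).1.2
  · exact ⟨1, one_pos, 0, le_rfl, (not_frequently.1 hfr).mono fun t ht ht' ↦ (ht ht').elim⟩

/-- Along an orbit segment that stays in `I \ C`, one application of `f` is Hölder at the limit
point, whether or not that limit point belongs to `C`. -/
theorem exists_holder_step (hf : IsPiecewiseC1Alpha f C α) (hord : HasCriticalOrders f C)
    {l : Filter ℝ} [l.NeBot] {u : ℝ → ℝ} {y y' : ℝ} (hu : Tendsto u l (𝓝 y))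
    (huI : ∀ᶠ t in l, u t ∈ I \ (C : Set ℝ)) (hfu : Tendsto (fun t ↦ f (u t)) l (𝓝 y')) :
    ∃ β > (0 : ℝ), ∃ K ≥ (0 : ℝ), ∀ᶠ t in l, |f (u t) - y'| ≤ K * |u t - y| ^ β := by
  have hyI : y ∈ I := isClosed_Icc.mem_of_tendsto hu (huI.mono fun t ht ↦ ht.1)
  by_cases hyC : y ∈ C
  · obtain ⟨β₁, hβ₁, K₁, hK₁, h₁⟩ :=
      exists_holder_on_side hord hu huI hfu hyI hyC Side.left
    obtain ⟨β₂, hβ₂, K₂, hK₂, h₂⟩ :=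
      exists_holder_on_side hord hu huI hfu hyI hyC Side.right
    refine ⟨min β₁ β₂, lt_min hβ₁ hβ₂, max K₁ K₂, hK₁.trans (le_max_left _ _), ?_⟩
    filter_upwards [h₁, h₂, huI] with t ht1 ht2 htI
    have hne : u t ≠ y := fun e ↦ htI.2 (e ▸ hyC)
    have hpos : 0 < |u t - y| := abs_pos.2 (sub_ne_zero.2 hne)
    have hle : |u t - y| ≤ 1 := by
      rw [abs_le]; constructor <;> linarith [htI.1.1, htI.1.2, hyI.1, hyI.2]
    have hlow : ∀ β, min β₁ β₂ ≤ β → |u t - y| ^ β ≤ |u t - y| ^ min β₁ β₂ := fun β hβ ↦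
      Real.rpow_le_rpow_of_exponent_ge hpos hle hβ
    have hcmp : ∀ K β, 0 ≤ K → K ≤ max K₁ K₂ → min β₁ β₂ ≤ β →
        K * |u t - y| ^ β ≤ max K₁ K₂ * |u t - y| ^ min β₁ β₂ := fun K β hK0 hK hβ ↦
      mul_le_mul hK (hlow β hβ) (by positivity) (hK0.trans hK)
    rcases lt_or_gt_of_ne hne with hlt | hgt
    · refine (ht1 ⟨?_, hlt⟩).trans (hcmp _ _ hK₁ (le_max_left _ _) (min_le_left _ _))
      show y - 2 < u t
      linarith [(abs_le.1 hle).1]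
    · refine (ht2 ⟨hgt, ?_⟩).trans (hcmp _ _ hK₂ (le_max_right _ _) (min_le_right _ _))
      show u t < y + 2
      linarith [(abs_le.1 hle).2]
  · have hd := hf.differentiable y ⟨hyI, hyC⟩
    have huW : Tendsto u l (𝓝[I] y) := tendsto_nhdsWithin_iff.2 ⟨hu, huI.mono fun t ht ↦ ht.1⟩
    have hy' : f y = y' := tendsto_nhds_unique (hd.continuousWithinAt.tendsto.comp huW) hfu
    obtain ⟨K, hK, hKb⟩ := (hd.isBigO_sub.comp_tendsto huW).exists_pos
    refine ⟨1, one_pos, K, hK.le, hKb.bound.mono fun t ht ↦ ?_⟩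
    simpa [hy', Real.norm_eq_abs] using ht

/-- The iterates of `f` along which the one-sided limits at `c` exist are Hölder at `c`. -/
theorem exists_holder_iterate (hf : IsPiecewiseC1Alpha f C α) (hord : HasCriticalOrders f C)
    {c : OneSidedPoint} {T : ℕ} {y : ℕ → ℝ} (hy0 : y 0 = c.pos)
    (hy : ∀ j ≤ T, Tendsto f^[j] c.approach (𝓝 (y j)))
    (hI : ∀ᶠ t in c.approach, ∀ j < T, f^[j] t ∈ I \ (C : Set ℝ)) :
    ∃ γ > (0 : ℝ), ∃ K ≥ (0 : ℝ), ∀ᶠ t in c.approach, |f^[T] t - y T| ≤ K * |t - c.pos| ^ γ := by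
  induction T with
  | zero =>
    refine ⟨1, one_pos, 1, zero_le_one, Eventually.of_forall fun t ↦ ?_⟩
    simp [hy0]
  | succ T ih =>
    obtain ⟨γ, hγ, K, hK, h⟩ := ih (fun j hj ↦ hy j (hj.trans T.le_succ))
      (hI.mono fun t ht j hj ↦ ht j (hj.trans T.lt_succ_self))
    have hstep := hy (T + 1) le_rfl
    rw [Function.iterate_succ'] at hstep
    obtain ⟨β, hβ, K', hK', h'⟩ := exists_holder_step hf hord (hy T T.le_succ)
      (hI.mono fun t ht ↦ ht T T.lt_succ_self) hstep
    refine ⟨γ * β, by positivity, K' * K ^ β, by positivity, ?_⟩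
    filter_upwards [h, h'] with t ht ht'
    rw [Function.iterate_succ_apply']
    calc |f (f^[T] t) - y (T + 1)| ≤ K' * |f^[T] t - y T| ^ β := ht'
      _ ≤ K' * (K * |t - c.pos| ^ γ) ^ β := by gcongr
      _ = _ := by
        rw [Real.mul_rpow hK (by positivity), ← Real.rpow_mul (abs_nonneg _), mul_assoc]

/-- The recurrence depth `log (1 / d)` of a point in the `δ`-zone of `S`. -/
def zoneDepth (C : Finset ℝ) (S : Set OneSidedPoint) (δ x : ℝ) : ℝ :=
  (zone S δ).indicator (fun x ↦ -Real.log (Metric.infDist x (C : Set ℝ))) x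

theorem IsUniformlySingular.zoneDepth_eq (hS : IsUniformlySingular f C S K θ δ₀) {δ x : ℝ}
    (hδ : δ ≤ δ₀) {s : OneSidedPoint} (hs : s ∈ S) (hx : x ∈ s.nbhd δ) :
    zoneDepth C S δ x = -Real.log |x - s.pos| := by
  rw [zoneDepth, indicator_of_mem (show x ∈ zone S δ from mem_biUnion hs hx),
    hS.infDist_eq s hs x (OneSidedPoint.nbhd_mono hδ hx)]

theorem IsUniformlySingular.zoneDepth_nonneg (hS : IsUniformlySingular f C S K θ δ₀) {δ : ℝ}
    (hδ : δ ≤ δ₀) (x : ℝ) : 0 ≤ zoneDepth C S δ x := by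
  by_cases hx : x ∈ zone S δ
  · obtain ⟨s, hs, hxs⟩ := mem_iUnion₂.1 hx
    rw [hS.zoneDepth_eq hδ hs hxs]
    have := OneSidedPoint.abs_sub_of_mem_nbhd hxs
    have h1 : |x - s.pos| ≤ 1 := this.2.le.trans (hδ.trans hS.le_one)
    linarith [Real.log_nonpos (abs_nonneg _) h1]
  · rw [zoneDepth, indicator_of_notMem hx]

/-- The depth at a one-sided point `c` of `𝒟` is, up to a constant factor, a depth at a singular
point: at once if `c` is singular, and after the `T` steps it takes `c` to reach the singular
set otherwise. -/
theorem exists_depth_le (hf : IsPiecewiseC1Alpha f C α) (hord : HasCriticalOrders f C)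
    (hS : IsUniformlySingular f C (singularPoints f C) K θ δ₀) {T₀ : ℕ} {c : OneSidedPoint}
    (hc : c ∈ oneSidedPoints C)
    (hvisit : c ∈ regularPoints f C → ∃ T : ℕ, 1 ≤ T ∧ T ≤ T₀ ∧
      (∀ j : ℕ, 0 < j → j < T → ∃ y : ℝ, Tendsto f^[j] c.approach (𝓝 y)) ∧
      ∃ s ∈ singularPoints f C, Tendsto f^[T] c.approach (𝓝 s.pos) ∧
        ∃ ε > 0, ∃ δ > 0, (∀ t ∈ c.nbhd δ, ∀ j < T, f^[j] t ∈ I \ (C : Set ℝ)) ∧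
          MapsTo f^[T] (c.nbhd δ) (s.nbhd ε)) :
    ∃ B > 0, ∃ T ≤ T₀, ∀ δ > 0, δ ≤ δ₀ → ∀ᶠ t in c.approach,
      -Real.log |t - c.pos| ≤ B * zoneDepth C (singularPoints f C) δ (f^[T] t) := by
  by_cases hcS : c ∈ singularPoints f C
  · refine ⟨1, one_pos, 0, Nat.zero_le _, fun δ hδ hδ₀ ↦ ?_⟩
    refine OneSidedPoint.eventually_approach.2 ⟨δ, hδ, fun t ht ↦ ?_⟩
    rw [Function.iterate_zero, id, hS.zoneDepth_eq hδ₀ hcS ht, one_mul]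
  · obtain ⟨T, hT1, hT, hlim, s, hs, hsT, ε, hε, η, hη, hI, hmaps⟩ := hvisit ⟨hc, hcS⟩
    have hy : ∀ j ≤ T, ∃ y : ℝ, Tendsto f^[j] c.approach (𝓝 y) ∧ (j = 0 → y = c.pos) ∧
        (j = T → y = s.pos) := by
      intro j hj
      rcases Nat.eq_zero_or_pos j with rfl | hj0
      · exact ⟨c.pos, c.approach_le, fun _ ↦ rfl, fun h ↦ by omega⟩
      · rcases hj.lt_or_eq with hlt | rfl
        · obtain ⟨y, hy⟩ := hlim j hj0 hlt
          exact ⟨y, hy, fun h ↦ by omega, fun h ↦ by omega⟩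
        · exact ⟨s.pos, hsT, fun h ↦ by omega, fun _ ↦ rfl⟩
    choose! y hy1 hy2 hy3 using hy
    obtain ⟨γ, hγ, B, hB, hhol⟩ := exists_holder_iterate hf hord (hy2 0 (Nat.zero_le _) rfl) hy1
      (OneSidedPoint.eventually_approach.2 ⟨η, hη, hI⟩)
    rw [hy3 T le_rfl rfl] at hhol
    refine ⟨2 / γ, by positivity, T, hT, fun δ hδ hδ₀ ↦ ?_⟩
    have hsmall : ∀ᶠ t in c.approach, B * |t - c.pos| ^ (γ / 2) ≤ 1 := by
      have hcont : Continuous fun t : ℝ ↦ B * |t - c.pos| ^ (γ / 2) :=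
        continuous_const.mul
          ((continuous_id.sub continuous_const).abs.rpow_const fun _ ↦ Or.inr (by positivity))
      have hl := (hcont.tendsto c.pos).mono_left c.approach_le
      simp only [sub_self, abs_zero, Real.zero_rpow (show γ / 2 ≠ 0 by positivity),
        mul_zero] at hl
      exact hl.eventually (ge_mem_nhds zero_lt_one)
    filter_upwards [hhol, hsmall, hsT.eventually (Metric.ball_mem_nhds _ hδ),
      OneSidedPoint.eventually_approach.2 ⟨η, hη, fun t ht ↦ ht⟩] with t h1 h2 h3 h4
    rw [Real.dist_eq] at h3
    have hts := hmaps h4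
    have hpos := (OneSidedPoint.abs_sub_of_mem_nbhd hts).1
    have htc := (OneSidedPoint.abs_sub_of_mem_nbhd h4).1
    rw [hS.zoneDepth_eq hδ₀ hs (OneSidedPoint.mem_nbhd_of_abs_lt hts h3)]
    have h5 : |f^[T] t - s.pos| ≤ |t - c.pos| ^ (γ / 2) := by
      calc |f^[T] t - s.pos| ≤ B * |t - c.pos| ^ γ := h1
        _ = B * |t - c.pos| ^ (γ / 2) * |t - c.pos| ^ (γ / 2) := by
          rw [mul_assoc, ← Real.rpow_add htc]; ring_nf
        _ ≤ 1 * |t - c.pos| ^ (γ / 2) := by gcongr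
        _ = _ := one_mul _
    have h6 := Real.log_le_log hpos h5
    rw [Real.log_rpow htc] at h6
    have h7 : 2 / γ * Real.log |f^[T] t - s.pos| ≤ 2 / γ * (γ / 2 * Real.log |t - c.pos|) := by
      gcongr
    have h8 : 2 / γ * (γ / 2 * Real.log |t - c.pos|) = Real.log |t - c.pos| := by field_simp
    linarith

/-- The truncated depth is at most twice the true depth, and vanishes away from `C`. -/
theorem logTruncDist_le {δ x : ℝ} (hδ : 0 < δ) (hδ1 : δ ≤ 1 / 4)
    (hx : 0 < Metric.infDist x (C : Set ℝ)) :
    logTruncDist C δ x ≤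
      if Metric.infDist x (C : Set ℝ) < 2 * δ then 2 * -Real.log (Metric.infDist x (C : Set ℝ))
      else 0 := by
  rw [logTruncDist, truncDist]
  set d := Metric.infDist x (C : Set ℝ)
  split_ifs with h1 h2 h2
  · have : Real.log d ≤ 0 := Real.log_nonpos hx.le (by linarith)
    rw [abs_of_nonpos this]; linarith
  · linarith
  · rw [not_le] at h1
    set e := (1 - δ) / δ * d + 2 * δ - 1 with he
    have he1 : δ ≤ e := by
      have : (1 - δ) / δ * δ ≤ (1 - δ) / δ * d := by
        gcongr
        exact div_nonneg (by linarith) hδ.le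
      rw [div_mul_cancel₀ _ hδ.ne'] at this
      linarith
    have he2 : e ≤ 1 := by
      have : (1 - δ) / δ * d ≤ (1 - δ) / δ * (2 * δ) := by
        gcongr
        exact div_nonneg (by linarith) hδ.le
      have h3 : (1 - δ) / δ * (2 * δ) = 2 * (1 - δ) := by field_simp
      linarith
    rw [abs_of_nonpos (Real.log_nonpos (by linarith) he2)]
    have h4 : d ^ 2 ≤ e := by nlinarith
    have h5 := Real.log_le_log (by positivity) h4
    rw [Real.log_pow] at h5
    push_cast at h5
    linarith
  · simp

/-- Every truncated depth along an orbit in `I \ C` is controlled by the depths at singular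
points within the next `T₀` steps. -/
theorem exists_logTruncDist_le_sum (hf : IsPiecewiseC1Alpha f C α)
    (hord : HasCriticalOrders f C)
    (hS : IsUniformlySingular f C (singularPoints f C) K θ δ₀)
    (hvisit : DiscontinuitiesVisitSingularities f C) :
    ∃ T₀ : ℕ, ∃ B > 0, ∀ δ > 0, δ ≤ δ₀ → ∃ η > 0, ∀ x ∈ I \ (C : Set ℝ),
      logTruncDist C η x ≤ B * ∑ j ∈ Finset.range (T₀ + 1),
        zoneDepth C (singularPoints f C) δ (f^[j] x) := by
  obtain ⟨T₀, -, hT₀⟩ := hvisit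
  have hpt : ∀ c ∈ oneSidedPoints C, ∃ B > 0, ∃ T ≤ T₀, ∀ δ > 0, δ ≤ δ₀ →
      ∀ᶠ t in c.approach,
        -Real.log |t - c.pos| ≤ B * zoneDepth C (singularPoints f C) δ (f^[T] t) := by
    refine fun c hc ↦ exists_depth_le hf hord hS hc fun hcr ↦ ?_
    obtain ⟨T, hT1, hT, hlim, s, hs, hsT, ε, hε, η, hη, hI, hdiff⟩ := hT₀ c hcr
    exact ⟨T, hT1, hT, fun j h0 h1 ↦ (hlim j h0 h1).imp fun y hy ↦ hy.1, s, hs, hsT, ε, hε, η, hη,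
      hI, hdiff.2.2.2⟩
  choose! B hB0 T hT hBT using hpt
  have hfin := finite_oneSidedPoints C
  have hBev : ∀ᶠ b in atTop, ∀ c ∈ oneSidedPoints C, B c ≤ b :=
    (hfin.eventually_all).2 fun c _ ↦ eventually_ge_atTop (B c)
  obtain ⟨b, hb, hb0⟩ := (hBev.and (eventually_gt_atTop 0)).exists
  refine ⟨T₀, 2 * b, by positivity, fun δ hδ hδ₀ ↦ ?_⟩
  choose! e he0 he using fun c hc ↦ OneSidedPoint.eventually_approach.1 (hBT c hc δ hδ hδ₀)
  have heev : ∀ᶠ η in 𝓝[>] (0 : ℝ), ∀ c ∈ oneSidedPoints C, 2 * η ≤ e c :=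
    (hfin.eventually_all).2 fun c hc ↦ by
      filter_upwards [Ioo_mem_nhdsGT (show 0 < e c / 2 by linarith [he0 c hc])] with η hη
      linarith [hη.2]
  obtain ⟨η, hη, hη1⟩ := (heev.and (Ioo_mem_nhdsGT (show (0 : ℝ) < 1 / 4 by norm_num))).exists
  refine ⟨η, hη1.1, fun x hx ↦ ?_⟩
  have hsum0 : ∀ j ∈ Finset.range (T₀ + 1),
      0 ≤ zoneDepth C (singularPoints f C) δ (f^[j] x) := fun j _ ↦ hS.zoneDepth_nonneg hδ₀ _
  have hsum : 0 ≤ ∑ j ∈ Finset.range (T₀ + 1),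
      zoneDepth C (singularPoints f C) δ (f^[j] x) := Finset.sum_nonneg hsum0
  rcases C.eq_empty_or_nonempty with hCe | hCne
  · -- With no points in `C` the junk distance `0` makes the truncated depth vanish.
    subst hCe
    have : logTruncDist ∅ η x = 0 := by
      simp [logTruncDist, truncDist, Metric.infDist_empty, hη1.1.le]
    rw [this]; positivity
  have hxd : 0 < Metric.infDist x (C : Set ℝ) :=
    (C.finite_toSet.isClosed.notMem_iff_infDist_pos hCne).1 hx.2
  refine (logTruncDist_le hη1.1 hη1.2.le hxd).trans ?_
  split_ifs with hnear
  · obtain ⟨p, hp, hpd⟩ := C.finite_toSet.isCompact.exists_infDist_eq_dist hCne x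
    rw [Real.dist_eq] at hpd
    obtain ⟨c, hc, hcp, hxc⟩ : ∃ c ∈ oneSidedPoints C, c.pos = p ∧ x ∈ c.nbhd (2 * η) := by
      rw [hpd] at hnear
      have hpI := hf.subset hp
      rcases lt_or_gt_of_ne (fun h : x = p ↦ hx.2 (h ▸ hp)) with hlt | hgt
      · refine ⟨⟨p, Side.left⟩, ⟨hp, hx.1.1.trans_lt hlt, hpI.2⟩, rfl, ?_, hlt⟩
        show p - 2 * η < x
        linarith [(abs_lt.1 hnear).1]
      · refine ⟨⟨p, Side.right⟩, ⟨hp, hpI.1, lt_of_lt_of_le hgt hx.1.2⟩, rfl, hgt, ?_⟩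
        show x < p + 2 * η
        linarith [(abs_lt.1 hnear).2]
    have h1 := he c hc x (OneSidedPoint.nbhd_mono (hη c hc) hxc)
    rw [hpd, ← hcp]
    have h2 : zoneDepth C (singularPoints f C) δ (f^[T c] x) ≤ ∑ j ∈ Finset.range (T₀ + 1),
        zoneDepth C (singularPoints f C) δ (f^[j] x) :=
      Finset.single_le_sum (f := fun j ↦ zoneDepth C (singularPoints f C) δ (f^[j] x)) hsum0
        (Finset.mem_range.2 (Nat.lt_succ_of_le (hT c hc)))
    have h3 : B c * zoneDepth C (singularPoints f C) δ (f^[T c] x) ≤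
        b * ∑ j ∈ Finset.range (T₀ + 1), zoneDepth C (singularPoints f C) δ (f^[j] x) :=
      mul_le_mul (hb c hc) h2 (hS.zoneDepth_nonneg hδ₀ _) hb0.le
    linarith
  · positivity

theorem sum_le_of_le_sum {a b : ℕ → ℝ} {B : ℝ} {T n M : ℕ} (hb : ∀ j, 0 ≤ b j) (hB : 0 ≤ B)
    (hM : n + T ≤ M) (hab : ∀ i < n, a i ≤ B * ∑ j ∈ Finset.range (T + 1), b (i + j)) :
    ∑ i ∈ Finset.range n, a i ≤ B * (T + 1) * ∑ l ∈ Finset.range M, b l := by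
  calc ∑ i ∈ Finset.range n, a i
      ≤ ∑ i ∈ Finset.range n, B * ∑ j ∈ Finset.range (T + 1), b (i + j) :=
        Finset.sum_le_sum fun i hi ↦ hab i (Finset.mem_range.1 hi)
    _ = B * ∑ j ∈ Finset.range (T + 1), ∑ i ∈ Finset.range n, b (j + i) := by
        rw [← Finset.mul_sum, Finset.sum_comm]
        simp_rw [add_comm]
    _ ≤ B * ∑ j ∈ Finset.range (T + 1), ∑ l ∈ Finset.range M, b l := by
        gcongr with j hj
        have hj' := Finset.mem_range.1 hj
        have hsplit := Finset.sum_range_add_sum_Ico b (show j ≤ j + n by omega)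
        have h1 : ∑ i ∈ Finset.range n, b (j + i) = ∑ l ∈ Finset.Ico j (j + n), b l := by
          rw [Finset.sum_Ico_eq_sum_range]; simp
        rw [h1]
        refine Finset.sum_le_sum_of_subset_of_nonneg (fun l hl ↦ ?_) fun l _ _ ↦ hb l
        rw [Finset.mem_Ico] at hl
        rw [Finset.mem_range]
        omega
    _ = _ := by
        rw [Finset.sum_const, Finset.card_range, nsmul_eq_mul]
        push_cast
        ring

end

noncomputable section

/-! ### Large deviations -/

variable {f : ℝ → ℝ} {C : Finset ℝ} {σ α : ℝ} {S : Set OneSidedPoint} {K θ δ₀ : ℝ}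

theorem limsup_log_lt_of_le_exp {a : ℕ → ENNReal} {D χ : ℝ} (hD : 0 < D) (hχ : 0 < χ)
    (ha : ∀ n : ℕ, 1 ≤ n → a n ≤ ENNReal.ofReal (D * Real.exp (-χ * n))) :
    limsup (fun n : ℕ ↦ ((1 / (n : ℝ) : ℝ) : EReal) * ENNReal.log (a n)) atTop <
      ((-(χ / 2) : ℝ) : EReal) := by
  have hlim : Tendsto (fun n : ℕ ↦ 1 / (n : ℝ) * (Real.log D - χ * n)) atTop (𝓝 (-χ)) := by
    have h1 : Tendsto (fun n : ℕ ↦ Real.log D * (1 / (n : ℝ)) - χ) atTop (𝓝 (-χ)) := by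
      simpa using (tendsto_one_div_atTop_nhds_zero_nat.const_mul (Real.log D)).sub_const χ
    refine h1.congr' ?_
    filter_upwards [eventually_ge_atTop 1] with n hn
    have : (n : ℝ) ≠ 0 := by positivity
    field_simp
  have hev : ∀ᶠ n : ℕ in atTop, ((1 / (n : ℝ) : ℝ) : EReal) * ENNReal.log (a n) ≤
      ((-(3 * χ / 4) : ℝ) : EReal) := by
    filter_upwards [eventually_ge_atTop 1,
      hlim.eventually (ge_mem_nhds (show -χ < -(3 * χ / 4) by linarith))] with n hn hn2
    have hlog : ENNReal.log (a n) ≤ ((Real.log D - χ * n : ℝ) : EReal) := by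
      refine (ENNReal.log_monotone (ha n hn)).trans (le_of_eq ?_)
      rw [ENNReal.log_ofReal_of_pos (by positivity), Real.log_mul hD.ne' (Real.exp_pos _).ne',
        Real.log_exp]
      congr 1
      ring
    calc ((1 / (n : ℝ) : ℝ) : EReal) * ENNReal.log (a n)
        ≤ ((1 / (n : ℝ) : ℝ) : EReal) * ((Real.log D - χ * n : ℝ) : EReal) :=
          mul_le_mul_of_nonneg_left hlog (EReal.coe_nonneg.2 (by positivity))
      _ = ((1 / (n : ℝ) * (Real.log D - χ * n) : ℝ) : EReal) := (EReal.coe_mul _ _).symm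
      _ ≤ _ := EReal.coe_le_coe_iff.2 hn2
  exact (limsup_le_of_le (by isBoundedDefault) hev).trans_lt
    (EReal.coe_lt_coe_iff.2 (by linarith))

theorem volume_exp_le_le {w : ℝ → ENNReal} (hw : Measurable w) (x : ℝ) {b : ℝ}
    (hb : ∫⁻ t in I, w t ≤ ENNReal.ofReal b) :
    volume {t ∈ I | ENNReal.ofReal (Real.exp x) ≤ w t} ≤
      ENNReal.ofReal (Real.exp (-x) * b) := by
  have hexp : ENNReal.ofReal (Real.exp x) ≠ 0 := by simpa using Real.exp_pos x
  have h1 := meas_ge_le_lintegral_div (μ := volume.restrict I) hw.aemeasurable hexp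
    ENNReal.ofReal_ne_top
  rw [Measure.restrict_apply (measurableSet_le measurable_const hw)] at h1
  have hset : {t ∈ I | ENNReal.ofReal (Real.exp x) ≤ w t} =
      {t | ENNReal.ofReal (Real.exp x) ≤ w t} ∩ I := by
    ext t; exact and_comm
  rw [hset]
  refine h1.trans ?_
  rw [Real.exp_neg, ENNReal.ofReal_mul (by positivity), ENNReal.ofReal_inv_of_pos (Real.exp_pos x),
    mul_comm, ← div_eq_mul_inv]
  gcongr

theorem ofReal_exp_sum_le_orbitProd {g : ℝ → ℝ} {ψ : ℝ → ENNReal} {b : ℝ → ℝ} {x : ℝ} {n : ℕ}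
    (h : ∀ j < n, ENNReal.ofReal (Real.exp (b (g^[j] x))) ≤ ψ (g^[j] x)) :
    ENNReal.ofReal (Real.exp (∑ j ∈ Finset.range n, b (g^[j] x))) ≤ orbitProd g ψ n x := by
  rw [Real.exp_sum, ENNReal.ofReal_prod_of_nonneg fun _ _ ↦ (Real.exp_pos _).le]
  exact Finset.prod_le_prod' fun j hj ↦ h j (Finset.mem_range.1 hj)

/-- The indicator of the `δ`-zone of `S`. -/
def zoneIndicator (S : Set OneSidedPoint) (δ : ℝ) : ℝ → ℝ := (zone S δ).indicator 1

theorem measurable_zoneIndicator (S : Set OneSidedPoint) (δ : ℝ) :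
    Measurable (zoneIndicator S δ) :=
  measurable_one.indicator (measurableSet_zone S δ)

theorem IsUniformlySingular.exp_le_depthWeight (hS : IsUniformlySingular f C S K θ δ₀)
    {κ δ' δ : ℝ} (hκ : 0 < κ) (hδ : δ ≤ δ') (hδ' : δ' ≤ δ₀) (x : ℝ) :
    ENNReal.ofReal (Real.exp (θ * zoneDepth C S δ x + Real.log κ * zoneIndicator S δ' x)) ≤
      depthWeight C S κ θ δ' δ x := by
  by_cases hx' : x ∈ zone S δ'
  · rw [depthWeight, if_pos hx', zoneIndicator, indicator_of_mem hx']
    refine ENNReal.ofReal_le_ofReal (le_of_eq ?_)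
    rw [Pi.one_apply, mul_one, add_comm, Real.exp_add, Real.exp_log hκ]
    congr 1
    by_cases hx : x ∈ zone S δ
    · obtain ⟨s, hs, hxs⟩ := mem_iUnion₂.1 hx
      rw [if_pos hx, hS.zoneDepth_eq (hδ.trans hδ') hs hxs,
        hS.infDist_eq s hs x (OneSidedPoint.nbhd_mono (hδ.trans hδ') hxs),
        Real.rpow_def_of_pos (OneSidedPoint.abs_sub_of_mem_nbhd hxs).1]
      congr 1
      ring
    · rw [if_neg hx, zoneDepth, indicator_of_notMem hx, mul_zero, Real.exp_zero]
  · have hx : x ∉ zone S δ := fun h ↦ hx' (zone_mono hδ h)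
    rw [depthWeight, if_neg hx', zoneIndicator, zoneDepth, indicator_of_notMem hx,
      indicator_of_notMem hx']
    simp

/-- In a sufficiently small zone the expansion dominates any given weight `Q`. -/
theorem IsUniformlySingular.exp_le_abs_der (h : IsExpandingOff f C σ)
    (hS : IsUniformlySingular f C S K θ δ₀) {δ' Q : ℝ} (hδ' : δ' ≤ δ₀)
    (hQ : Real.exp Q * K * δ' ^ (2 * θ) ≤ 1) {x : ℝ} (hx : x ∈ I \ (C : Set ℝ)) :
    ENNReal.ofReal (Real.exp (Q * zoneIndicator S δ' x)) ≤ ENNReal.ofReal |der f x| := by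
  refine ENNReal.ofReal_le_ofReal ?_
  by_cases hxz : x ∈ zone S δ'
  · rw [zoneIndicator, indicator_of_mem hxz, Pi.one_apply, mul_one]
    obtain ⟨s, hs, hxs⟩ := mem_iUnion₂.1 hxz
    obtain ⟨β, hβ, hβθ, hord⟩ := hS.order s hs
    obtain ⟨h0, h1⟩ := OneSidedPoint.abs_sub_of_mem_nbhd hxs
    refine le_trans ?_ (hord x (OneSidedPoint.nbhd_mono hδ' hxs)).1
    have hK : 0 < K := by linarith [hS.one_le]
    have hθ := hS.theta_pos
    have h2 : |x - s.pos| ^ (1 - β) ≤ δ' ^ (2 * θ) := by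
      calc |x - s.pos| ^ (1 - β) ≤ |x - s.pos| ^ (2 * θ) :=
            Real.rpow_le_rpow_of_exponent_ge h0 (h1.le.trans (hδ'.trans hS.le_one)) hβθ
        _ ≤ _ := by gcongr
    have h3 : |x - s.pos| ^ (β - 1) = (|x - s.pos| ^ (1 - β))⁻¹ := by
      rw [← Real.rpow_neg h0.le]; ring_nf
    have h4 : 0 < |x - s.pos| ^ (1 - β) := by positivity
    rw [h3, ← mul_inv, ← one_div, le_div_iff₀ (by positivity), ← mul_assoc]
    exact le_trans (by gcongr) hQ
  · rw [zoneIndicator, indicator_of_notMem hxz, mul_zero, Real.exp_zero]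
    exact h.one_lt.le.trans (h.le_abs_der x hx)

/-- A zone so small that passages through it are both very expanding and cheap. -/
theorem exists_small_zone (h : IsExpandingOff f C σ) (hS : IsUniformlySingular f C S K θ δ₀)
    (hδ₀ : 0 < δ₀) (Q : ℝ) : ∃ δ' > 0, δ' ≤ δ₀ ∧ Real.exp Q * K * δ' ^ (2 * θ) ≤ 1 ∧
      2 * K * (δ' ^ θ * (1 - (1 / 2) ^ θ)⁻¹) ≤ σ⁻¹ := by
  have hθ := hS.theta_pos
  have hσ : 0 < σ⁻¹ := inv_pos.2 (by linarith [h.one_lt])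
  have hpow : ∀ a : ℝ, 0 < a → Tendsto (fun d : ℝ ↦ d ^ a) (𝓝[>] 0) (𝓝 0) := by
    intro a ha
    have := (Real.continuousAt_rpow_const 0 a (Or.inr ha.le)).tendsto
    rw [Real.zero_rpow ha.ne'] at this
    exact this.mono_left nhdsWithin_le_nhds
  have h1 := (hpow (2 * θ) (by positivity)).const_mul (Real.exp Q * K)
  have h2 := ((hpow θ hθ).mul_const (1 - (1 / 2 : ℝ) ^ θ)⁻¹).const_mul (2 * K)
  rw [mul_zero] at h1
  rw [zero_mul, mul_zero] at h2
  obtain ⟨d, ⟨hd1, hd2⟩, hd3⟩ := (((h1.eventually (ge_mem_nhds zero_lt_one)).and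
    (h2.eventually (ge_mem_nhds hσ))).and (Ioo_mem_nhdsGT hδ₀)).exists
  exact ⟨d, hd3.1, hd3.2.le, hd1, hd2⟩

/-- The set where the depths at singular points add up to a positive proportion of `n` is
exponentially small. Orbits which visit the zone with frequency at least `ν` are discarded by
counting branches; on the other ones the penalty `κ` in the weight is negligible. -/
theorem exists_volume_zoneDepth_le (hα : 0 < α) (hf : IsPiecewiseC1Alpha f C α)
    (h : IsExpandingOff f C σ) (hreg : IsHolderNearRegularPoints f C α) (hδ₀ : 0 < δ₀)
    (hS : IsUniformlySingular f C (singularPoints f C) K θ δ₀) {ε : ℝ} (hε : 0 < ε) (T : ℕ) :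
    ∃ δ > 0, δ ≤ δ₀ ∧ ∃ D > 0, ∃ χ > 0, ∃ M : ℕ → ℕ, ∀ n, n + T ≤ M n ∧
      volume {t ∈ I | ε * n ≤ ∑ j ∈ Finset.range (M n),
        zoneDepth C (singularPoints f C) δ ((branchMap f C)^[j] t)} ≤
      ENNReal.ofReal (D * Real.exp (-χ * n)) := by
  set S := singularPoints f C with hSdef
  set g := branchMap f C with hg
  have hθ := hS.theta_pos
  have hK := hS.one_le
  set ω := θ * ε with hω
  have hω0 : 0 < ω := by positivity
  set κ := 1 / (2 * K ^ 2) with hκ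
  have hκ0 : 0 < κ := by positivity
  have hlogκ : Real.log κ < 0 := by
    refine Real.log_neg hκ0 ?_
    rw [hκ, div_lt_one (by positivity)]
    nlinarith
  -- The threshold `ν` for the frequency of visits makes the total penalty at most `ω / 4`.
  set ν := ω / (4 * -Real.log κ) with hν
  have hν0 : 0 < ν := div_pos hω0 (by linarith)
  have hνκ : Real.log κ * ν = -(ω / 4) := by
    rw [hν]
    have : Real.log κ ≠ 0 := hlogκ.ne
    field_simp
  set p : ℝ := 2 ^ C.card with hp
  have hp1 : 1 ≤ p := one_le_pow₀ (by norm_num)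
  set Q := (Real.log p + 1) / ν with hQ
  have hQ0 : 0 < Q := div_pos (by linarith [Real.log_nonneg hp1]) hν0
  have hQν : Q * ν = Real.log p + 1 := div_mul_cancel₀ _ hν0.ne'
  obtain ⟨δ', hδ'0, hδ', hδ'Q, hδ'ρ⟩ := exists_small_zone h hS hδ₀ Q
  have hr1 : 1 < Real.exp (ω / 16) := Real.one_lt_exp_iff.2 (by positivity)
  obtain ⟨F, hF⟩ := exists_isAdapted hα hf h hreg hδ'0 hr1
  obtain ⟨N, hN, A, hA, δ, hδ0, hδδ', hgrow⟩ :=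
    exists_lintegral_orbitProd_le h hS hr1 hF hδ'0 hδ' hδ'ρ
  refine ⟨δ, hδ0, hδδ'.trans hδ', 1 + (A + 1) * Real.exp (ω * (T + N) / 2), by positivity,
    min 1 (ω / 2), lt_min one_pos (by positivity), fun n ↦ ((n + T) / N + 1) * N, fun n ↦ ?_⟩
  set M := ((n + T) / N + 1) * N with hM
  have hM1 : n + T ≤ M := by
    have h1 := Nat.div_add_mod (n + T) N
    have h2 := Nat.mod_lt (n + T) hN
    rw [hM, add_mul, one_mul, mul_comm]
    omega
  have hM2 : M ≤ n + T + N := by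
    have h1 := Nat.div_mul_le_self (n + T) N
    rw [hM, add_mul, one_mul]
    omega
  refine ⟨hM1, ?_⟩
  have hM1' : (n : ℝ) ≤ M := by exact_mod_cast (Nat.le_add_right n T).trans hM1
  have hM2' : (M : ℝ) ≤ n + T + N := by exact_mod_cast hM2
  set ψ := depthWeight C S κ θ δ' δ with hψ
  set φ : ℝ → ENNReal := fun x ↦ ENNReal.ofReal (Real.exp (Q * zoneIndicator S δ' x)) with hφ
  have hφm : Measurable φ := ENNReal.measurable_ofReal.comp
    (Real.measurable_exp.comp (measurable_const.mul (measurable_zoneIndicator S δ')))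
  have hgm : Measurable g := h.measurable_branchMap
  have hcover : {t ∈ I | ε * n ≤ ∑ j ∈ Finset.range M, zoneDepth C S δ (g^[j] t)} ⊆
      {t ∈ I | ENNReal.ofReal (Real.exp (Q * ν * M)) ≤ orbitProd g φ M t} ∪
      {t ∈ I | ENNReal.ofReal (Real.exp (ω * n - ω / 4 * M)) ≤ orbitProd g ψ M t} := by
    rintro t ⟨htI, ht⟩
    rcases le_or_gt (ν * M) (∑ j ∈ Finset.range M, zoneIndicator S δ' (g^[j] t)) with hV | hV
    · refine Or.inl ⟨htI, le_trans (ENNReal.ofReal_le_ofReal (Real.exp_le_exp.2 ?_))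
        (ofReal_exp_sum_le_orbitProd (b := fun x ↦ Q * zoneIndicator S δ' x)
          fun j _ ↦ le_rfl)⟩
      rw [← Finset.mul_sum, mul_assoc]
      gcongr
    · refine Or.inr ⟨htI, le_trans (ENNReal.ofReal_le_ofReal (Real.exp_le_exp.2 ?_))
        (ofReal_exp_sum_le_orbitProd
          (b := fun x ↦ θ * zoneDepth C S δ x + Real.log κ * zoneIndicator S δ' x)
          fun j _ ↦ hS.exp_le_depthWeight hκ0 hδδ' hδ' _)⟩
      rw [Finset.sum_add_distrib, ← Finset.mul_sum, ← Finset.mul_sum]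
      have h1 : ω * n ≤ θ * ∑ j ∈ Finset.range M, zoneDepth C S δ (g^[j] t) := by
        rw [hω, mul_assoc]; gcongr
      have h2 : Real.log κ * (ν * M) ≤
          Real.log κ * ∑ j ∈ Finset.range M, zoneIndicator S δ' (g^[j] t) :=
        mul_le_mul_of_nonpos_left hV.le hlogκ.le
      rw [← mul_assoc, hνκ] at h2
      linarith
  have hvol1 := volume_exp_le_le (measurable_orbitProd hgm hφm M) (Q * ν * M)
    (h.lintegral_orbitProd_le (fun x hx ↦ hS.exp_le_abs_der h hδ' hδ'Q hx) M)
  have hvol2 := volume_exp_le_le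
    (measurable_orbitProd hgm (measurable_depthWeight C S κ θ δ' δ) M) (ω * n - ω / 4 * M)
    (hgrow ((n + T) / N + 1))
  refine (measure_mono hcover).trans ((measure_union_le _ _).trans
    ((add_le_add hvol1 hvol2).trans ?_))
  rw [← ENNReal.ofReal_add (by positivity) (by positivity)]
  refine ENNReal.ofReal_le_ofReal ?_
  have hn0 : (0 : ℝ) ≤ n := n.cast_nonneg
  have e1 : Real.exp (-(Q * ν * M)) * (2 ^ C.card) ^ M ≤ Real.exp (-min 1 (ω / 2) * n) := by
    rw [← hp, ← Real.rpow_natCast p, Real.rpow_def_of_pos (by positivity), ← Real.exp_add, hQν]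
    refine Real.exp_le_exp.2 ?_
    have := mul_le_mul_of_nonneg_right (min_le_left 1 (ω / 2)) hn0
    linarith
  have e2 : Real.exp (-(ω * n - ω / 4 * M)) * ((Real.exp (ω / 16) ^ 4) ^ M * (A + 1)) ≤
      (A + 1) * Real.exp (ω * (T + N) / 2) * Real.exp (-min 1 (ω / 2) * n) := by
    rw [← mul_assoc, mul_comm _ (A + 1), mul_assoc (A + 1)]
    refine mul_le_mul_of_nonneg_left ?_ (by positivity)
    rw [← Real.exp_nat_mul, ← Real.exp_nat_mul, ← Real.exp_add, ← Real.exp_add]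
    refine Real.exp_le_exp.2 ?_
    have := mul_le_mul_of_nonneg_right (min_le_right 1 (ω / 2)) hn0
    push_cast
    nlinarith
  calc _ ≤ Real.exp (-min 1 (ω / 2) * n) +
        (A + 1) * Real.exp (ω * (T + N) / 2) * Real.exp (-min 1 (ω / 2) * n) := add_le_add e1 e2
    _ = _ := by ring

theorem hasExponentiallySlowRecurrence (hα : 0 < α) (hf : IsPiecewiseC1Alpha f C α)
    (hord : HasCriticalOrders f C) (hreg : IsHolderNearRegularPoints f C α)
    (hexp : IsUniformlyExpanding f C) (hvisit : DiscontinuitiesVisitSingularities f C) :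
    HasExponentiallySlowRecurrence f C := by
  intro ε hε
  obtain ⟨σ, h⟩ := exists_isExpandingOff hf hexp
  obtain ⟨K, θ, δ₀, hδ₀, hsing⟩ := exists_isUniformlySingular f C
  obtain ⟨T, B, hB, hdepth⟩ := exists_logTruncDist_le_sum hf hord hsing hvisit
  obtain ⟨δ, hδ0, hδ, D, hD, χ, hχ, M, hM⟩ := exists_volume_zoneDepth_le hα hf h hreg hδ₀ hsing
    (show 0 < ε / (B * (T + 1)) by positivity) T
  obtain ⟨η, hη, hηdepth⟩ := hdepth δ hδ0 hδ
  refine ⟨η, hη, χ / 2, by positivity, limsup_log_lt_of_le_exp hD hχ fun n hn ↦ ?_⟩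
  -- Almost every orbit avoids `C`, so that `f` may be replaced by `branchMap f C`.
  have hnull : volume (⋃ j : ℕ, {t ∈ I | (branchMap f C)^[j] t ∈ (C : Set ℝ)}) = 0 :=
    measure_iUnion_null fun j ↦ (h.finite_iterate_preimage C.finite_toSet j).measure_zero _
  refine le_trans (measure_mono (t := (⋃ j : ℕ, {t ∈ I | (branchMap f C)^[j] t ∈ (C : Set ℝ)}) ∪
    {t ∈ I | ε / (B * (T + 1)) * n ≤ ∑ j ∈ Finset.range (M n),
      zoneDepth C (singularPoints f C) δ ((branchMap f C)^[j] t)}) ?_)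
    ((measure_union_le _ _).trans (by rw [hnull, zero_add]; exact (hM n).2))
  rintro t ⟨htI, ht⟩
  by_cases hbad : t ∈ ⋃ j : ℕ, {t ∈ I | (branchMap f C)^[j] t ∈ (C : Set ℝ)}
  · exact Or.inl hbad
  · refine Or.inr ⟨htI, ?_⟩
    have horb : ∀ j, (branchMap f C)^[j] t ∈ I \ (C : Set ℝ) := fun j ↦
      ⟨h.iterate_mem htI j, fun hj ↦ hbad (mem_iUnion.2 ⟨j, htI, hj⟩)⟩
    have heq : ∀ j, f^[j] t = (branchMap f C)^[j] t := fun j ↦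
      iterate_eq_branchMap_iterate fun i _ ↦ horb i
    have hsum := sum_le_of_le_sum (a := fun j ↦ logTruncDist C η (f^[j] t))
      (b := fun j ↦ zoneDepth C (singularPoints f C) δ (f^[j] t)) (T := T) (n := n)
      (fun j ↦ hsing.zoneDepth_nonneg hδ _) hB.le (hM n).1 fun i _ ↦ by
        have := hηdepth (f^[i] t) (by rw [heq]; exact horb i)
        simpa only [← Function.iterate_add_apply, add_comm] using this
    have hn0 : (0 : ℝ) < n := by exact_mod_cast hn
    rw [one_div, lt_inv_mul_iff₀ hn0] at ht
    simp_rw [← heq]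
    rw [div_mul_eq_mul_div, div_le_iff₀ (by positivity)]
    linarith

end
end SlowRecurrence

theorem theoremC (α : ℝ) (hα : 0 < α) (hα1 : α ≤ 1) (f : ℝ → ℝ) (C : Finset ℝ)
    (hf : SlowRecurrence.IsPiecewiseC1Alpha f C α)
    (hord : SlowRecurrence.HasCriticalOrders f C)
    (hreg : SlowRecurrence.IsHolderNearRegularPoints f C α)
    (hexp : SlowRecurrence.IsUniformlyExpanding f C)
    (hS : (SlowRecurrence.singularPoints f C).Nonempty)
    (hvisit : SlowRecurrence.DiscontinuitiesVisitSingularities f C) :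
    SlowRecurrence.HasExponentiallySlowRecurrence f C :=
  SlowRecurrence.hasExponentiallySlowRecurrence hα hf hord hreg hexp hvisit
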